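/- All graphs are finite and simple, and the girth of a graph is the length of its shortest cycle. For an integer $k\ge 3$, a graph is $C_k$-colorable if it admits a homomorphism to the cycle $C_k$ of length $k$. Let $f(k)$ be the smallest integer $m\ge 0$ such that every planar graph of girth $k$ without cycles of length from $k+1$ to $m$ is $C_k$-colorable (with $f(k)=\infty$ if no such $m$ exists). If $f(5)\le 17$, then every planar graph is (properly) $5$-colorable. -/

import Mathlib

/-- The Euclidean plane. -/
abbrev Plane : Type := EuclideanSpace ℝ (Fin 2)

/-- `A` is a polygonal arc with ends `x` and `y`: a union of finitely many nondegenerate straight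
line segments `[p 0, p 1], …, [p (n - 1), p n]` with `p 0 = x` and `p n = y`, in which two
consecutive segments meet only in their common end and any other two segments are disjoint
(only the values `p 0, …, p n` matter). -/
def IsPolygonalArc (A : Set Plane) (x y : Plane) : Prop :=
  ∃ (n : ℕ) (p : ℕ → Plane),
    1 ≤ n ∧ p 0 = x ∧ p n = y ∧
    A = ⋃ i ∈ Set.Iio n, segment ℝ (p i) (p (i + 1)) ∧
    (∀ i < n, p i ≠ p (i + 1)) ∧
    (∀ i, i + 1 < n →
      segment ℝ (p i) (p (i + 1)) ∩ segment ℝ (p (i + 1)) (p (i + 2)) = {p (i + 1)}) ∧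
    (∀ i j, i + 1 < j → j < n →
      Disjoint (segment ℝ (p i) (p (i + 1))) (segment ℝ (p j) (p (j + 1))))

/-- A drawing of `G` in the plane without crossings: vertices are distinct points, every edge is a
polygonal arc joining its ends, and the interior of an edge contains no vertex and no point of any
other edge. -/
structure PlaneDrawing {V : Type*} (G : SimpleGraph V) where
  /-- The point that represents a vertex. -/
  pos : V → Plane
  /-- The arc that represents an edge (its values on non-edges are irrelevant). -/
  arc : Sym2 V → Set Plane
  pos_injective : Function.Injective pos
  isPolygonalArc : ∀ u v, G.Adj u v → IsPolygonalArc (arc s(u, v)) (pos u) (pos v)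
  vertex_mem_arc : ∀ e ∈ G.edgeSet, ∀ w, pos w ∈ arc e → w ∈ e
  arc_inter_arc : ∀ e ∈ G.edgeSet, ∀ e' ∈ G.edgeSet, e ≠ e' → arc e ∩ arc e' ⊆ Set.range pos

/-- A graph is planar if it can be drawn in the plane without crossings. -/
def IsPlanar {V : Type*} (G : SimpleGraph V) : Prop :=
  Nonempty (PlaneDrawing G)

/-- `G` has no cycle whose length lies between `a` and `b` (inclusive). -/
def NoCycleOfLength {V : Type*} (G : SimpleGraph V) (a b : ℕ) : Prop :=
  ∀ (v : V) (c : G.Walk v v), c.IsCycle → ¬ (a ≤ c.length ∧ c.length ≤ b)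

/-- `G` is `C_k`-colorable: it admits a homomorphism to the cycle of length `k`. -/
def IsCycleColorable {V : Type*} (G : SimpleGraph V) (k : ℕ) : Prop :=
  Nonempty (G →g SimpleGraph.cycleGraph k)

/-- Every finite planar graph of girth `k` without cycles of length from `k + 1` to `m` is
`C_k`-colorable. -/
def SteinbergProperty (k m : ℕ) : Prop :=
  ∀ (V : Type) [Finite V] (G : SimpleGraph V),
    IsPlanar G → G.egirth = k → NoCycleOfLength G (k + 1) m → IsCycleColorable G k

/-- `f(k)`: the smallest `m` such that every planar graph of girth `k` without cycles of length
from `k + 1` to `m` is `C_k`-colorable, and `⊤` if there is no such `m`. -/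
noncomputable def steinbergNumber (k : ℕ) : ℕ∞ :=
  ⨅ (m : ℕ) (_ : SteinbergProperty k m), (m : ℕ∞)

/-! Replace every edge of a planar graph by a chain of three pentagons glued at joints, the two
joints of each pentagon being at distance two in it. A homomorphism to `C₅` maps each pentagon
bijectively, so the colors of its two joints differ by `±2`. A sum of three such terms is `±2` or
`±6`, never `0` modulo `5`, so a `C₅`-coloring of the new graph restricts to a proper `5`-coloring
of the old vertices (`pentagonGraph_hom_ne`).

A cycle of the new graph is either one of the pentagons or follows a cycle of the old graph. In the
second case it crosses at least three chains, hence nine pentagons, with at least two edges in each,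
so its length is at least `18` (`pentagonGraph_cycle_length`). The new graph therefore has girth `5`
and no cycle of length `6` to `17`.

The long part is planarity (`ArcSystem.isPlanar_pentagonGraph`). Each arc is refined to at least
nine segments and gets a parallel copy, in which every corner except the joints is pushed to the
left by a small multiple `ε` of a shift vector. The arc carries the short sides of the pentagons and
the copy carries the long sides. Any two segments meet correctly for all small `ε > 0`, and there
are finitely many pairs. -/

open Filter Topology

/-! ### Perturbation of segments in the plane -/

/-- The determinant of two plane vectors. -/
def planeDet (x y : Plane) : ℝ := x 0 * y 1 - x 1 * y 0

theorem plane_ext {x y : Plane} (h0 : x 0 = y 0) (h1 : x 1 = y 1) : x = y := by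
  ext i; fin_cases i <;> assumption

theorem mem_segment_iff_coord {a b x : Plane} :
    x ∈ segment ℝ a b ↔ ∃ t : ℝ, 0 ≤ t ∧ t ≤ 1 ∧
      x 0 = a 0 + t * (b 0 - a 0) ∧ x 1 = a 1 + t * (b 1 - a 1) := by
  rw [segment_eq_image']
  constructor
  · rintro ⟨t, ⟨h0, h1⟩, rfl⟩
    exact ⟨t, h0, h1, by simp, by simp⟩
  · rintro ⟨t, h0, h1, hx, hy⟩
    exact ⟨t, ⟨h0, h1⟩, plane_ext (by simp [hx]) (by simp [hy])⟩

/-- Being distinct is an open condition on a pair of points, and the pairs are parametrized by a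
compact square, so one neighbourhood of `0` serves all of them. -/
theorem eventually_disjoint_segment {a b c d : ℝ → Plane} (ha : Continuous a) (hb : Continuous b)
    (hc : Continuous c) (hd : Continuous d)
    (h : Disjoint (segment ℝ (a 0) (b 0)) (segment ℝ (c 0) (d 0))) :
    ∀ᶠ ε in 𝓝 (0 : ℝ), Disjoint (segment ℝ (a ε) (b ε)) (segment ℝ (c ε) (d ε)) := by
  have hK : IsCompact (Set.Icc (0 : ℝ) 1 ×ˢ Set.Icc (0 : ℝ) 1) := isCompact_Icc.prod isCompact_Icc
  have := hK.eventually_forall_of_forall_eventually (x₀ := (0 : ℝ))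
    (P := fun ε q => a ε + q.1 • (b ε - a ε) ≠ c ε + q.2 • (d ε - c ε)) (by
      rintro ⟨t, r⟩ ⟨ht, hr⟩
      have hcont : ContinuousAt (fun z : ℝ × ℝ × ℝ =>
          (a z.1 + z.2.1 • (b z.1 - a z.1), c z.1 + z.2.2 • (d z.1 - c z.1))) (0, t, r) := by
        fun_prop
      have hne : a 0 + t • (b 0 - a 0) ≠ c 0 + r • (d 0 - c 0) := by
        intro he
        have h1 : a 0 + t • (b 0 - a 0) ∈ segment ℝ (a 0) (b 0) := by
          rw [segment_eq_image']; exact ⟨t, ht, rfl⟩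
        have h2 : a 0 + t • (b 0 - a 0) ∈ segment ℝ (c 0) (d 0) := by
          rw [he, segment_eq_image']; exact ⟨r, hr, rfl⟩
        exact Set.disjoint_left.1 h h1 h2
      exact hcont.eventually ((isOpen_ne_fun continuous_fst continuous_snd).mem_nhds hne))
  filter_upwards [this] with ε hε
  rw [Set.disjoint_left]
  intro x hx hy
  rw [segment_eq_image'] at hx hy
  obtain ⟨t, ht, rfl⟩ := hx
  obtain ⟨r, hr, he⟩ := hy
  exact hε (t, r) ⟨ht, hr⟩ he.symm

/-- Two vectors do not point in the same direction. -/
def DirectionsDiffer (x y : Plane) : Prop := planeDet x y ≠ 0 ∨ x 0 * y 0 + x 1 * y 1 < 0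

/-- Otherwise the two vectors are positive multiples of each other, and the shorter segment lies
inside the longer one. -/
theorem directionsDiffer_of_segment {z a b : Plane} (ha : a ≠ z) (hb : b ≠ z)
    (h : ∀ x ∈ segment ℝ z a, x ∈ segment ℝ z b → x = z) : DirectionsDiffer (a - z) (b - z) := by
  by_contra hcon
  simp only [DirectionsDiffer, planeDet, not_or, not_not, not_lt, PiLp.sub_apply] at hcon
  obtain ⟨hdet, hdot⟩ := hcon
  set A := (a 0 - z 0) * (a 0 - z 0) + (a 1 - z 1) * (a 1 - z 1) with hA
  set B := (b 0 - z 0) * (b 0 - z 0) + (b 1 - z 1) * (b 1 - z 1) with hB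
  set C := (a 0 - z 0) * (b 0 - z 0) + (a 1 - z 1) * (b 1 - z 1) with hC
  have pos : ∀ {c : Plane}, c ≠ z →
      0 < (c 0 - z 0) * (c 0 - z 0) + (c 1 - z 1) * (c 1 - z 1) := by
    intro c hc
    by_contra hle
    have h0 : c 0 - z 0 = 0 := by nlinarith [mul_self_nonneg (c 0 - z 0), mul_self_nonneg (c 1 - z 1)]
    have h1 : c 1 - z 1 = 0 := by nlinarith [mul_self_nonneg (c 0 - z 0), mul_self_nonneg (c 1 - z 1)]
    exact hc (plane_ext (by linarith) (by linarith))
  have hA0 : 0 < A := pos ha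
  have hB0 : 0 < B := pos hb
  have hCA : C ^ 2 = A * B := by
    -- Lagrange's identity: dot product squared plus determinant squared.
    have : C ^ 2 + ((a 0 - z 0) * (b 1 - z 1) - (a 1 - z 1) * (b 0 - z 0)) ^ 2 = A * B := by
      rw [hA, hB, hC]; ring
    rw [hdet] at this; linarith
  have hC0 : 0 < C := by
    rcases hdot.lt_or_eq with h | h
    · exact h
    · rw [← h] at hCA; nlinarith
  have e0 : A * (b 0 - z 0) = C * (a 0 - z 0) := by rw [hA, hC]; linear_combination (-(a 1 - z 1)) * hdet
  have e1 : A * (b 1 - z 1) = C * (a 1 - z 1) := by rw [hA, hC]; linear_combination (a 0 - z 0) * hdet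
  rcases le_total C A with hle | hle
  · apply hb
    refine h b (mem_segment_iff_coord.2 ⟨C / A, by positivity, by rw [div_le_one hA0]; exact hle, ?_, ?_⟩)
      (right_mem_segment ..)
    · field_simp; linarith
    · field_simp; linarith
  · apply ha
    refine h a (right_mem_segment ..)
      (mem_segment_iff_coord.2 ⟨A / C, by positivity, by rw [div_le_one hC0]; exact hle, ?_, ?_⟩)
    · field_simp; linarith
    · field_simp; linarith

theorem DirectionsDiffer.eq_apex {z a b x : Plane} (h : DirectionsDiffer (a - z) (b - z))
    (hx : x ∈ segment ℝ z a) (hy : x ∈ segment ℝ z b) : x = z := by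
  obtain ⟨t, ht0, -, h0, h1⟩ := mem_segment_iff_coord.1 hx
  obtain ⟨r, hr0, -, h2, h3⟩ := mem_segment_iff_coord.1 hy
  have ht : t = 0 := by
    rcases h with h | h
    · simp only [planeDet, PiLp.sub_apply] at h
      refine (mul_eq_zero.1 ?_).resolve_right h
      linear_combination (b 1 - z 1) * (h2 - h0) - (b 0 - z 0) * (h3 - h1)
    · simp only [PiLp.sub_apply] at h
      have : t * ((a 0 - z 0) * (b 0 - z 0) + (a 1 - z 1) * (b 1 - z 1)) =
          r * ((b 0 - z 0) ^ 2 + (b 1 - z 1) ^ 2) := by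
        linear_combination (b 1 - z 1) * (h3 - h1) + (b 0 - z 0) * (h2 - h0)
      have h4 : 0 ≤ r * ((b 0 - z 0) ^ 2 + (b 1 - z 1) ^ 2) := by positivity
      rw [← this] at h4
      by_contra hne
      have : 0 < t := lt_of_le_of_ne ht0 (Ne.symm hne)
      nlinarith
  subst ht
  exact plane_ext (by simpa using h0) (by simpa using h1)

/-- Compactness does not apply to segments that share a moving end. Instead the hypothesis is turned
into `DirectionsDiffer`, an open condition on the directions at the apex. -/
theorem eventually_segment_inter_apex {z a b : ℝ → Plane} (hz : Continuous z) (ha : Continuous a)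
    (hb : Continuous b) (hza : a 0 ≠ z 0) (hzb : b 0 ≠ z 0)
    (h : ∀ x ∈ segment ℝ (z 0) (a 0), x ∈ segment ℝ (z 0) (b 0) → x = z 0) :
    ∀ᶠ ε in 𝓝 (0 : ℝ), ∀ x ∈ segment ℝ (z ε) (a ε), x ∈ segment ℝ (z ε) (b ε) → x = z ε := by
  have key : ∀ᶠ ε in 𝓝 (0 : ℝ), DirectionsDiffer (a ε - z ε) (b ε - z ε) := by
    rcases directionsDiffer_of_segment hza hzb h with h | h
    · have : Continuous fun ε => planeDet (a ε - z ε) (b ε - z ε) := by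
        unfold planeDet; fun_prop
      filter_upwards [this.continuousAt.eventually_ne h] with ε hε using Or.inl hε
    · have : Continuous fun ε => (a ε - z ε) 0 * (b ε - z ε) 0 + (a ε - z ε) 1 * (b ε - z ε) 1 := by
        fun_prop
      filter_upwards [this.continuousAt.eventually (gt_mem_nhds h)] with ε hε using Or.inr hε
  filter_upwards [key] with ε hε x hx hy using hε.eq_apex hx hy

/-- At a bend `a, z, b` of a polygonal arc, the shifted copy of `[z, b]` avoids `[a, z]` when the
shift of `z` points to the same side of both segments. The sign `σ` selects the side. -/
theorem eventually_disjoint_shift_bend {a z b s r : Plane} (σ : ℝ)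
    (hsa : 0 < σ * planeDet (z - a) s) (hsb : 0 < σ * planeDet (b - z) s)
    (hr : 0 ≤ σ * planeDet (b - z) r) (hbz : b ≠ z)
    (h : ∀ x ∈ segment ℝ a z, x ∈ segment ℝ z b → x = z) :
    ∀ᶠ ε in 𝓝[>] (0 : ℝ),
      Disjoint (segment ℝ a z) (segment ℝ (z + ε • s) (b + ε • r)) := by
  have hb : Disjoint (segment ℝ a z) (segment ℝ b b) := by
    rw [segment_same, Set.disjoint_singleton_right]
    exact fun hm => hbz (h b hm (right_mem_segment ..))
  have ev1 := eventually_disjoint_segment (a := fun _ => a) (b := fun _ => z)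
    (c := fun ε => b + ε • r) (d := fun ε => b + ε • r) (by fun_prop) (by fun_prop) (by fun_prop)
    (by fun_prop) (by simpa using hb)
  -- One of two lines separates. If `a` is not strictly on the shift side of line `zb`, that line
  -- works. Otherwise `b` is strictly on the shift side of line `az`, stays there for small `ε`, and
  -- line `az` works.
  have ev2 : ∀ᶠ ε in 𝓝 (0 : ℝ), σ * planeDet (b - z) (a - z) ≤ 0 ∨
      σ * planeDet (a - z) (b + ε • r - z) < 0 := by
    by_cases hle : σ * planeDet (b - z) (a - z) ≤ 0
    · exact Eventually.of_forall fun _ => Or.inl hle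
    · have hc : Continuous fun ε : ℝ => σ * planeDet (a - z) (b + ε • r - z) := by
        unfold planeDet; fun_prop
      have h0 : σ * planeDet (a - z) (b + (0 : ℝ) • r - z) < 0 := by
        push Not at hle
        simp only [planeDet, PiLp.sub_apply, PiLp.add_apply, PiLp.smul_apply, smul_eq_mul] at hle ⊢
        linarith
      filter_upwards [hc.continuousAt.eventually (gt_mem_nhds h0)] with ε hε using Or.inr hε
  filter_upwards [nhdsWithin_le_nhds ev1, nhdsWithin_le_nhds ev2, self_mem_nhdsWithin]
    with ε h1 h2 hε
  have hε : 0 < ε := hε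
  rw [Set.disjoint_left]
  intro x hx hy
  obtain ⟨t', ht0, ht1, hx0, hx1⟩ := mem_segment_iff_coord.1 (segment_symm ℝ a z ▸ hx)
  obtain ⟨q, hq0, hq1, hy0, hy1⟩ := mem_segment_iff_coord.1 hy
  -- The end `b + ε • r` needs its own argument, because `r` may be zero and the strict inequalities
  -- come only from `s`.
  have hq : q ≠ 1 := by
    rintro rfl
    have : x = b + ε • r := plane_ext (by linarith) (by linarith)
    rw [segment_same, Set.disjoint_singleton_right] at h1
    exact h1 (this ▸ hx)
  have hq' : 0 < 1 - q := by
    rcases hq1.lt_or_eq with h | h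
    · linarith
    · exact absurd h hq
  simp only [planeDet, PiLp.sub_apply, PiLp.add_apply, PiLp.smul_apply, smul_eq_mul] at *
  rcases h2 with h2 | h2
  · have e : t' * (σ * ((b 0 - z 0) * (a 1 - z 1) - (b 1 - z 1) * (a 0 - z 0))) =
        (1 - q) * ε * (σ * ((b 0 - z 0) * s 1 - (b 1 - z 1) * s 0)) +
          q * ε * (σ * ((b 0 - z 0) * r 1 - (b 1 - z 1) * r 0)) := by
      linear_combination σ * (b 0 - z 0) * (hy1 - hx1) - σ * (b 1 - z 1) * (hy0 - hx0)
    have e1 := mul_nonneg ht0 (neg_nonneg.2 h2)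
    have e2 := mul_pos (mul_pos hq' hε) hsb
    have e3 := mul_nonneg (mul_nonneg hq0 hε.le) hr
    linarith
  · have e : 0 = (1 - q) * ε * (σ * ((z 0 - a 0) * s 1 - (z 1 - a 1) * s 0)) +
          q * -(σ * ((a 0 - z 0) * (b 1 + ε * r 1 - z 1) - (a 1 - z 1) * (b 0 + ε * r 0 - z 0))) := by
      linear_combination σ * (z 0 - a 0) * (hy1 - hx1) - σ * (z 1 - a 1) * (hy0 - hx0)
    have e2 := mul_pos (mul_pos hq' hε) hsa
    have e3 := mul_nonneg hq0 (neg_nonneg.2 h2.le)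
    linarith

/-- A segment and its shifted copy meet only in an end that is not shifted. -/
theorem segment_inter_shift {a b s r x : Plane} {ε : ℝ} (hε : 0 < ε)
    (hs : s = 0 ∨ 0 < planeDet (b - a) s) (hr : r = 0 ∨ 0 < planeDet (b - a) r)
    (hsr : ¬ (s = 0 ∧ r = 0)) (hx : x ∈ segment ℝ a b)
    (hy : x ∈ segment ℝ (a + ε • s) (b + ε • r)) : (s = 0 ∧ x = a) ∨ (r = 0 ∧ x = b) := by
  obtain ⟨t, ht0, ht1, hx0, hx1⟩ := mem_segment_iff_coord.1 hx
  obtain ⟨q, hq0, hq1, hy0, hy1⟩ := mem_segment_iff_coord.1 hy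
  simp only [PiLp.add_apply, PiLp.smul_apply, smul_eq_mul] at *
  -- The determinant with `b - a` vanishes along the line `ab`, so only the shifts contribute.
  have e : 0 = (1 - q) * (ε * planeDet (b - a) s) + q * (ε * planeDet (b - a) r) := by
    simp only [planeDet, PiLp.sub_apply]
    linear_combination (b 0 - a 0) * (hy1 - hx1) - (b 1 - a 1) * (hy0 - hx0)
  rcases hs with hs | hs <;> rcases hr with hr | hr
  · exact absurd ⟨hs, hr⟩ hsr
  · have h0 : planeDet (b - a) s = 0 := by simp [planeDet, hs]
    have : q = 0 := by
      rw [h0] at e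
      exact (mul_eq_zero.1 (by linarith : q * (ε * planeDet (b - a) r) = 0)).resolve_right
        (mul_pos hε hr).ne'
    subst this
    subst hs
    exact Or.inl ⟨rfl, plane_ext (by simpa using hy0) (by simpa using hy1)⟩
  · have h0 : planeDet (b - a) r = 0 := by simp [planeDet, hr]
    have : 1 - q = 0 := by
      rw [h0] at e
      exact (mul_eq_zero.1 (by linarith : (1 - q) * (ε * planeDet (b - a) s) = 0)).resolve_right
        (mul_pos hε hs).ne'
    have : q = 1 := by linarith
    subst this
    subst hr
    exact Or.inr ⟨rfl, plane_ext (by simpa using hy0) (by simpa using hy1)⟩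
  · have h1 := mul_pos hε hs
    have h2 := mul_pos hε hr
    rcases hq0.lt_or_eq with h | h
    · have := mul_pos h h2
      have := mul_nonneg (sub_nonneg.2 hq1) h1.le
      linarith
    · rw [← h] at e; linarith

/-- At a proper bend the sum of the two arms, up to sign, lies on the left of both segments. At a
straight corner a normal vector does, and folding back is excluded by `DirectionsDiffer`. -/
theorem exists_common_side {a z b : Plane} (ha : a ≠ z) (hb : b ≠ z)
    (h : ∀ x ∈ segment ℝ a z, x ∈ segment ℝ z b → x = z) :
    ∃ s : Plane, 0 < planeDet (z - a) s ∧ 0 < planeDet (b - z) s := by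
  have hd := directionsDiffer_of_segment ha hb (by rwa [segment_symm])
  rcases lt_trichotomy (planeDet (a - z) (b - z)) 0 with hlt | heq | hgt
  · refine ⟨(a - z) + (b - z), ?_⟩
    simp only [planeDet, PiLp.sub_apply, PiLp.add_apply] at *
    constructor <;> linarith
  · have hdot := hd.resolve_left (not_not.2 heq)
    refine ⟨!₂[-(b 1 - z 1), b 0 - z 0], ?_⟩
    simp only [planeDet, PiLp.sub_apply] at *
    have hb' : 0 < (b 0 - z 0) ^ 2 + (b 1 - z 1) ^ 2 := by
      by_contra hle
      have h0 : b 0 - z 0 = 0 := by nlinarith [sq_nonneg (b 0 - z 0), sq_nonneg (b 1 - z 1)]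
      have h1 : b 1 - z 1 = 0 := by nlinarith [sq_nonneg (b 0 - z 0), sq_nonneg (b 1 - z 1)]
      exact hb (plane_ext (by linarith) (by linarith))
    constructor
    · simp; linarith
    · simp; linarith
  · refine ⟨-((a - z) + (b - z)), ?_⟩
    simp only [planeDet, PiLp.sub_apply, PiLp.add_apply, PiLp.neg_apply] at *
    constructor <;> linarith

/-! ### Planarity from a straight-line subdivision -/

theorem IsPolygonalArc.symm {A : Set Plane} {x y : Plane} (h : IsPolygonalArc A x y) :
    IsPolygonalArc A y x := by
  obtain ⟨n, p, hn, h0, hend, hA, hne, hcons, hfar⟩ := h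
  have hseg : ∀ i < n, segment ℝ (p (n - i)) (p (n - (i + 1))) =
      segment ℝ (p (n - 1 - i)) (p (n - 1 - i + 1)) := by
    intro i hi
    rw [segment_symm, show n - (i + 1) = n - 1 - i by omega, show n - i = n - 1 - i + 1 by omega]
  refine ⟨n, fun i => p (n - i), hn, by simpa using hend, by simpa using h0, ?_, ?_, ?_, ?_⟩
  · rw [hA]
    ext z
    simp only [Set.mem_iUnion, Set.mem_Iio, exists_prop]
    constructor
    · rintro ⟨i, hi, hz⟩
      refine ⟨n - 1 - i, by omega, ?_⟩
      rw [hseg _ (by omega), show n - 1 - (n - 1 - i) = i by omega]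
      exact hz
    · rintro ⟨i, hi, hz⟩
      rw [hseg i hi] at hz
      exact ⟨n - 1 - i, by omega, hz⟩
  · intro i hi
    have := hne (n - 1 - i) (by omega)
    rw [show n - 1 - i + 1 = n - i by omega, show n - 1 - i = n - (i + 1) by omega] at this
    exact this.symm
  · intro i hi
    have := hcons (n - 2 - i) (by omega)
    dsimp only
    rw [hseg i (by omega), show i + 2 = i + 1 + 1 from rfl, hseg (i + 1) hi, Set.inter_comm,
      show n - 1 - (i + 1) = n - 2 - i by omega, show n - 1 - i = n - 2 - i + 1 by omega,
      show n - (i + 1) = n - 2 - i + 1 by omega]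
    exact this
  · intro i j hij hj
    dsimp only
    rw [hseg i (by omega), hseg j hj]
    exact (hfar _ _ (by omega) (by omega)).symm

/-- A graph is planar if it has a subdivision that is drawn with straight segments: `P` places the
nodes of the subdivision, `H` is its adjacency, and each edge `d` of the graph is a path
`w d 0, …, w d (len d)` of the subdivision. -/
theorem isPlanar_of_straight_subdivision {W X D : Type*} [Nonempty D] (P : W → Plane) (H : W → W → Prop)
    (hne : ∀ a b, H a b → P a ≠ P b)
    (hinter : ∀ a b c d, H a b → H c d → s(a, b) ≠ s(c, d) →
      ∀ x ∈ segment ℝ (P a) (P b), x ∈ segment ℝ (P c) (P d) →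
        ∃ w, w ∈ s(a, b) ∧ w ∈ s(c, d) ∧ x = P w)
    (G : SimpleGraph X) (ι : X → W) (hι : Function.Injective ι) (hX : ∀ x, ∃ y, G.Adj x y)
    (src tgt : D → X) (len : D → ℕ) (w : D → ℕ → W)
    (hD : ∀ x y, G.Adj x y → ∃ d, s(src d, tgt d) = s(x, y))
    (hlen : ∀ d, 1 ≤ len d)
    (hsrc : ∀ d, w d 0 = ι (src d)) (htgt : ∀ d, w d (len d) = ι (tgt d))
    (hH : ∀ d, ∀ i < len d, H (w d i) (w d (i + 1)))
    (hinj : ∀ d, ∀ i ≤ len d, ∀ j ≤ len d, w d i = w d j → i = j)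
    (hint : ∀ d, ∀ i ≤ len d, ∀ x, w d i = ι x → i = 0 ∨ i = len d)
    (hcross : ∀ d d', d ≠ d' → ∀ i ≤ len d, ∀ j ≤ len d', w d i = w d' j → i = 0 ∨ i = len d) :
    IsPlanar G := by
  classical
  -- a node that is an end of some segment lies on no other segment
  have hnode : ∀ a b c d, H a b → H c d → ∀ v, v ∈ s(a, b) → P v ∈ segment ℝ (P c) (P d) →
      v ∈ s(c, d) := by
    intro a b c d hab hcd v hv hx
    by_cases he : s(a, b) = s(c, d)
    · rwa [← he]
    · have hx' : P v ∈ segment ℝ (P a) (P b) := by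
        rcases Sym2.mem_iff.1 hv with rfl | rfl
        · exact left_mem_segment ..
        · exact right_mem_segment ..
      obtain ⟨u, hu, hu', hP⟩ := hinter a b c d hab hcd he _ hx' hx
      have : v = u := by
        have := hne a b hab
        rcases Sym2.mem_iff.1 hv with rfl | rfl <;> rcases Sym2.mem_iff.1 hu with rfl | rfl
        · rfl
        · exact absurd hP this
        · exact absurd hP.symm this
        · rfl
      rwa [this]
  -- `hinter` controls only points on segments, so every vertex must be an end of one. This is where
  -- isolated vertices are ruled out.
  have hinc : ∀ x, ∃ a b, H a b ∧ ι x ∈ s(a, b) := by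
    intro x
    obtain ⟨y, hy⟩ := hX x
    obtain ⟨d, hd⟩ := hD x y hy
    have : x ∈ s(src d, tgt d) := by rw [hd]; exact Sym2.mem_mk_left _ _
    have hl := hlen d
    rcases Sym2.mem_iff.1 this with rfl | rfl
    · exact ⟨_, _, hH d 0 (by omega), by rw [hsrc]; exact Sym2.mem_mk_left _ _⟩
    · refine ⟨_, _, hH d (len d - 1) (by omega), ?_⟩
      rw [show len d - 1 + 1 = len d by omega, htgt]; exact Sym2.mem_mk_right _ _
  have hpos : Function.Injective fun x => P (ι x) := by
    intro x y hxy
    obtain ⟨a, b, hab, hx⟩ := hinc x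
    obtain ⟨c, d, hcd, hy⟩ := hinc y
    have hy' : P (ι y) ∈ segment ℝ (P c) (P d) := by
      rcases Sym2.mem_iff.1 hy with h | h <;> rw [h]
      · exact left_mem_segment ..
      · exact right_mem_segment ..
    have hxm := hnode a b c d hab hcd _ hx (by rw [show P (ι x) = P (ι y) from hxy]; exact hy')
    have hn := hne c d hcd
    apply hι
    rcases Sym2.mem_iff.1 hxm with h | h <;> rcases Sym2.mem_iff.1 hy with h' | h' <;>
      simp only [h, h'] at hxy ⊢
    · exact absurd hxy hn
    · exact absurd hxy.symm hn
  let A : D → Set Plane := fun d => ⋃ i ∈ Set.Iio (len d), segment ℝ (P (w d i)) (P (w d (i + 1)))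
  have hA : ∀ d, IsPolygonalArc (A d) (P (ι (src d))) (P (ι (tgt d))) := by
    intro d
    have hshare : ∀ i j, i < j → j < len d → ∀ x ∈ segment ℝ (P (w d i)) (P (w d (i + 1))),
        x ∈ segment ℝ (P (w d j)) (P (w d (j + 1))) → j = i + 1 ∧ x = P (w d (i + 1)) := by
      intro i j hij hj x hx hx'
      have hne' : s(w d i, w d (i + 1)) ≠ s(w d j, w d (j + 1)) := by
        intro h
        have : w d i ∈ s(w d j, w d (j + 1)) := by rw [← h]; exact Sym2.mem_mk_left _ _
        rcases Sym2.mem_iff.1 this with h | h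
        · have := hinj d _ (by omega) _ (by omega) h; omega
        · have := hinj d _ (by omega) _ (by omega) h; omega
      obtain ⟨v, hv, hv', rfl⟩ := hinter _ _ _ _ (hH d i (by omega)) (hH d j hj) hne' x hx hx'
      rcases Sym2.mem_iff.1 hv with rfl | rfl <;> rcases Sym2.mem_iff.1 hv' with h | h <;>
        have := hinj d _ (by omega) _ (by omega) h
      · omega
      · omega
      · exact ⟨this.symm, rfl⟩
      · omega
    refine ⟨len d, fun i => P (w d i), hlen d, by simp [hsrc], by simp [htgt], rfl, ?_, ?_, ?_⟩
    · exact fun i hi => hne _ _ (hH d i hi)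
    · intro i hi
      refine Set.Subset.antisymm ?_ ?_
      · rintro x ⟨hx, hx'⟩
        exact (hshare i (i + 1) (by omega) hi x hx hx').2
      · rintro x rfl
        exact ⟨right_mem_segment .., left_mem_segment ..⟩
    · intro i j hij hj
      rw [Set.disjoint_left]
      intro x hx hx'
      have := (hshare i j (by omega) hj x hx hx').1
      omega
  have hex : ∀ e ∈ G.edgeSet, ∃ d, s(src d, tgt d) = e := by
    intro e
    induction e with
    | _ x y => exact fun h => hD x y h
  choose! δ hδ using hex
  refine ⟨⟨fun x => P (ι x), fun e => A (δ e), hpos, ?_, ?_, ?_⟩⟩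
  · intro u v huv
    rcases Sym2.eq_iff.1 (hδ s(u, v) huv) with ⟨h1, h2⟩ | ⟨h1, h2⟩
    · have := hA (δ s(u, v)); rwa [h1, h2] at this
    · have := (hA (δ s(u, v))).symm; rwa [h1, h2] at this
  · intro e he v hv
    simp only [A, Set.mem_iUnion, Set.mem_Iio, exists_prop] at hv
    obtain ⟨i, hi, hv⟩ := hv
    obtain ⟨a, b, hab, hm⟩ := hinc v
    have hm' := hnode a b _ _ hab (hH _ i hi) _ hm hv
    have key : ∀ j ≤ len (δ e), ι v = w (δ e) j → v ∈ e := by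
      intro j hj hvj
      rw [← hδ e he]
      rcases hint _ j hj v hvj.symm with rfl | rfl
      · rw [hsrc] at hvj; rw [hι hvj]; exact Sym2.mem_mk_left _ _
      · rw [htgt] at hvj; rw [hι hvj]; exact Sym2.mem_mk_right _ _
    rcases Sym2.mem_iff.1 hm' with h | h
    · exact key _ (by omega) h
    · exact key _ (by omega) h
  · rintro e he e' he' hee x ⟨hx, hx'⟩
    simp only [A, Set.mem_iUnion, Set.mem_Iio, exists_prop] at hx hx'
    obtain ⟨i, hi, hx⟩ := hx
    obtain ⟨j, hj, hx'⟩ := hx'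
    have hdd : δ e ≠ δ e' := by
      intro h; apply hee; rw [← hδ e he, ← hδ e' he', h]
    have hends : ∀ d, ∀ k, (k = 0 ∨ k = len d) → ∃ u ∈ s(src d, tgt d), w d k = ι u := by
      rintro d k (rfl | rfl)
      · exact ⟨_, Sym2.mem_mk_left _ _, hsrc d⟩
      · exact ⟨_, Sym2.mem_mk_right _ _, htgt d⟩
    -- A segment common to two paths has only end nodes, so both paths consist of that segment and
    -- the edges have the same ends.
    have hne' : s(w (δ e) i, w (δ e) (i + 1)) ≠ s(w (δ e') j, w (δ e') (j + 1)) := by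
      intro h
      have shared : ∀ d d' i j, d ≠ d' → i < len d → j < len d' →
          s(w d i, w d (i + 1)) = s(w d' j, w d' (j + 1)) → i = 0 ∧ len d = 1 := by
        intro d d' i j hdd hi hj h
        have h1 : i = 0 ∨ i = len d := by
          have : w d i ∈ s(w d' j, w d' (j + 1)) := by rw [← h]; exact Sym2.mem_mk_left _ _
          rcases Sym2.mem_iff.1 this with h | h
          · exact hcross d d' hdd i (by omega) j (by omega) h
          · exact hcross d d' hdd i (by omega) (j + 1) (by omega) h
        have h2 : i + 1 = 0 ∨ i + 1 = len d := by
          have : w d (i + 1) ∈ s(w d' j, w d' (j + 1)) := by rw [← h]; exact Sym2.mem_mk_right _ _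
          rcases Sym2.mem_iff.1 this with h | h
          · exact hcross d d' hdd (i + 1) (by omega) j (by omega) h
          · exact hcross d d' hdd (i + 1) (by omega) (j + 1) (by omega) h
        omega
      obtain ⟨hi0, hl⟩ := shared _ _ i j hdd hi hj h
      obtain ⟨hj0, hl'⟩ := shared _ _ j i hdd.symm hj hi h.symm
      subst hi0 hj0
      have e1 := htgt (δ e)
      have e2 := htgt (δ e')
      rw [hl] at e1
      rw [hl'] at e2
      rw [zero_add, hsrc, hsrc, e1, e2] at h
      apply hee
      rw [← hδ e he, ← hδ e' he']
      rcases Sym2.eq_iff.1 h with ⟨h1, h2⟩ | ⟨h1, h2⟩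
      · rw [hι h1, hι h2]
      · rw [hι h1, hι h2, Sym2.eq_swap]
    obtain ⟨v, hv, hv', rfl⟩ := hinter _ _ _ _ (hH _ i hi) (hH _ j hj) hne' x hx hx'
    have : ∃ k ≤ len (δ e), v = w (δ e) k := by
      rcases Sym2.mem_iff.1 hv with h | h
      · exact ⟨_, by omega, h⟩
      · exact ⟨_, by omega, h⟩
    obtain ⟨k, hk, rfl⟩ := this
    have hk' : k = 0 ∨ k = len (δ e) := by
      rcases Sym2.mem_iff.1 hv' with h | h
      · exact hcross _ _ hdd k hk j (by omega) h
      · exact hcross _ _ hdd k hk (j + 1) (by omega) h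
    obtain ⟨u, -, hu⟩ := hends _ k hk'
    exact ⟨u, by rw [hu]⟩

theorem IsPlanar.comap {V U : Type*} {G : SimpleGraph V} (hG : IsPlanar G) (f : U ↪ V) :
    IsPlanar (G.comap f) := by
  obtain ⟨d⟩ := hG
  have hmem : ∀ e ∈ (G.comap f).edgeSet, e.map f ∈ G.edgeSet := by
    intro e
    induction e with
    | _ x y => exact fun h => h
  refine ⟨⟨fun u => d.pos (f u), fun e => d.arc (e.map f), d.pos_injective.comp f.injective,
    fun u v h => d.isPolygonalArc _ _ h, ?_, ?_⟩⟩
  · intro e he w hw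
    obtain ⟨u, hu, huw⟩ := Sym2.mem_map.1 (d.vertex_mem_arc _ (hmem e he) _ hw)
    rwa [← f.injective huw]
  · rintro e he e' he' hne x hx
    have hne' : e.map f ≠ e'.map f := fun h => hne (Sym2.map.injective f.injective h)
    obtain ⟨v, rfl⟩ := d.arc_inter_arc _ (hmem e he) _ (hmem e' he') hne' hx
    have hv := d.vertex_mem_arc _ (hmem e he) _ hx.1
    obtain ⟨u, -, rfl⟩ := Sym2.mem_map.1 hv
    exact ⟨u, rfl⟩

/-! ### Refinement of polygonal arcs -/

/-- The corners of a polygonal arc. -/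
def IsArcChain (n : ℕ) (p : ℕ → Plane) : Prop :=
  (∀ i < n, p i ≠ p (i + 1)) ∧
  (∀ i, i + 1 < n → ∀ x ∈ segment ℝ (p i) (p (i + 1)),
    x ∈ segment ℝ (p (i + 1)) (p (i + 2)) → x = p (i + 1)) ∧
  (∀ i j, i + 1 < j → j < n →
    Disjoint (segment ℝ (p i) (p (i + 1))) (segment ℝ (p j) (p (j + 1))))

/-- Cut the first segment at its midpoint. Iterating this gives enough corners to place the
pentagons. -/
theorem IsArcChain.exists_refinement {n : ℕ} {p : ℕ → Plane} (hn : 1 ≤ n) (h : IsArcChain n p) :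
    ∃ q : ℕ → Plane, IsArcChain (n + 1) q ∧ q 0 = p 0 ∧ q (n + 1) = p n ∧
      ⋃ i ∈ Set.Iio (n + 1), segment ℝ (q i) (q (i + 1)) ⊆
        ⋃ i ∈ Set.Iio n, segment ℝ (p i) (p (i + 1)) := by
  obtain ⟨hne, hcons, hfar⟩ := h
  set m := midpoint ℝ (p 0) (p 1) with hm
  have m0 : m 0 = (p 0 0 + p 1 0) / 2 := by simp [hm, midpoint_eq_smul_add]; ring
  have m1 : m 1 = (p 0 1 + p 1 1) / 2 := by simp [hm, midpoint_eq_smul_add]; ring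
  have h01 := hne 0 (by omega)
  simp only [zero_add] at h01
  have hmem : m ∈ segment ℝ (p 0) (p 1) := midpoint_mem_segment ..
  have sub1 : segment ℝ (p 0) m ⊆ segment ℝ (p 0) (p 1) :=
    (convex_segment ..).segment_subset (left_mem_segment ..) hmem
  have sub2 : segment ℝ m (p 1) ⊆ segment ℝ (p 0) (p 1) :=
    (convex_segment ..).segment_subset hmem (right_mem_segment ..)
  have hmid : ∀ x ∈ segment ℝ (p 0) m, x ∈ segment ℝ m (p 1) → x = m := by
    intro x hx hx'
    refine DirectionsDiffer.eq_apex (a := p 0) (b := p 1) (Or.inr ?_) (by rwa [segment_symm]) hx'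
    have : 0 < (p 0 0 - p 1 0) ^ 2 + (p 0 1 - p 1 1) ^ 2 := by
      by_contra hle
      have h0 : p 0 0 - p 1 0 = 0 := by
        nlinarith [sq_nonneg (p 0 0 - p 1 0), sq_nonneg (p 0 1 - p 1 1)]
      have h1 : p 0 1 - p 1 1 = 0 := by
        nlinarith [sq_nonneg (p 0 0 - p 1 0), sq_nonneg (p 0 1 - p 1 1)]
      exact h01 (plane_ext (by linarith) (by linarith))
    simp only [PiLp.sub_apply, m0, m1]
    nlinarith
  have hm0 : p 0 ≠ m := by
    intro h
    apply h01
    have e0 := congrArg (fun z : Plane => z 0) h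
    have e1 := congrArg (fun z : Plane => z 1) h
    simp only [m0, m1] at e0 e1
    exact plane_ext (by linarith) (by linarith)
  have hm1 : m ≠ p 1 := by
    intro h
    apply h01
    have e0 := congrArg (fun z : Plane => z 0) h
    have e1 := congrArg (fun z : Plane => z 1) h
    simp only [m0, m1] at e0 e1
    exact plane_ext (by linarith) (by linarith)
  let q : ℕ → Plane := fun i => match i with
    | 0 => p 0
    | 1 => m
    | i + 2 => p (i + 1)
  refine ⟨q, ⟨?_, ?_, ?_⟩, rfl, ?_, ?_⟩
  · rintro (_ | _ | i) hi
    · exact hm0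
    · exact hm1
    · exact hne (i + 1) (by omega)
  · rintro (_ | _ | i) hi x hx hx'
    · exact hmid x hx hx'
    · exact hcons 0 (by omega) x (sub2 hx) hx'
    · exact hcons (i + 1) (by omega) x hx hx'
  · rintro (_ | _ | i) (_ | _ | j) hij hj
    · omega
    · omega
    · rw [Set.disjoint_left]
      intro x hx hx'
      rcases Nat.eq_zero_or_pos j with rfl | hj0
      · have := hcons 0 (by omega) x (sub1 hx) hx'
        subst this
        exact hm1 (hmid _ hx (right_mem_segment ..)).symm
      · exact Set.disjoint_left.1 (hfar 0 (j + 1) (by omega) (by omega)) (sub1 hx) hx'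
    · omega
    · omega
    · exact (hfar 0 (j + 1) (by omega) (by omega)).mono_left sub2
    · omega
    · omega
    · exact hfar (i + 1) (j + 1) (by omega) (by omega)
  · obtain ⟨k, rfl⟩ : ∃ k, n = k + 1 := ⟨n - 1, by omega⟩
    rfl
  · intro x hx
    simp only [Set.mem_iUnion, Set.mem_Iio, exists_prop] at hx ⊢
    obtain ⟨i, hi, hx⟩ := hx
    match i, hi, hx with
    | 0, _, hx => exact ⟨0, by omega, sub1 hx⟩
    | 1, _, hx => exact ⟨0, by omega, sub2 hx⟩
    | i + 2, hi, hx => exact ⟨i + 1, by omega, hx⟩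

theorem IsPolygonalArc.exists_long_chain {A : Set Plane} {x y : Plane} (h : IsPolygonalArc A x y)
    (k : ℕ) : ∃ (n : ℕ) (p : ℕ → Plane), k < n ∧ IsArcChain n p ∧ p 0 = x ∧ p n = y ∧
      ⋃ i ∈ Set.Iio n, segment ℝ (p i) (p (i + 1)) ⊆ A := by
  induction k with
  | zero =>
    obtain ⟨n, p, hn, h0, hend, hA, hne, hcons, hfar⟩ := h
    refine ⟨n, p, hn, ⟨hne, fun i hi x hx hx' => ?_, hfar⟩, h0, hend, hA.ge⟩
    have : x ∈ ({p (i + 1)} : Set Plane) := hcons i hi ▸ ⟨hx, hx'⟩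
    exact this
  | succ k ih =>
    obtain ⟨n, p, hn, hp, h0, hend, hA⟩ := ih
    obtain ⟨q, hq, q0, qend, hsub⟩ := hp.exists_refinement (by omega)
    exact ⟨n + 1, q, by omega, hq, q0.trans h0, qend.trans hend, hsub.trans hA⟩

/-! ### Arcs and their parallel copies -/

/-- A drawing of a multigraph by polygonal arcs, given by the corners `p e 0, …, p e (N e)` of the
arc of each edge `e`. -/
structure ArcSystem (V E : Type*) where
  pos : V → Plane
  src : E → V
  tgt : E → V
  N : E → ℕ
  p : E → ℕ → Plane
  src_ne_tgt : ∀ e, src e ≠ tgt e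
  -- Three pentagons, each with a long side of three edges. The joints sit at corners `0`, `3`, `6`
  -- and `N e`, and the last edges absorb any surplus segments.
  nine_le : ∀ e, 9 ≤ N e
  chain : ∀ e, IsArcChain (N e) (p e)
  p_zero : ∀ e, p e 0 = pos (src e)
  p_end : ∀ e, p e (N e) = pos (tgt e)
  pos_mem : ∀ v e i, i < N e → pos v ∈ segment ℝ (p e i) (p e (i + 1)) →
    (v = src e ∧ i = 0) ∨ (v = tgt e ∧ i + 1 = N e)
  inter : ∀ e e', e ≠ e' → ∀ i < N e, ∀ j < N e', ∀ x ∈ segment ℝ (p e i) (p e (i + 1)),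
    x ∈ segment ℝ (p e' j) (p e' (j + 1)) → ∃ v, x = pos v

namespace ArcSystem

variable {V E : Type*} (S : ArcSystem V E)

/-- The corners at which an arc and its parallel copy are glued. -/
def IsJoint (e : E) (i : ℕ) : Prop := i = 0 ∨ i = 3 ∨ i = 6 ∨ i = S.N e

/-- `s` shifts every corner that is not a joint to the left of the arc. -/
def IsLeftShift (s : E → ℕ → Plane) : Prop :=
  (∀ e i, S.IsJoint e i → s e i = 0) ∧
  ∀ e i, i + 1 < S.N e → ¬ S.IsJoint e (i + 1) →
    0 < planeDet (S.p e (i + 1) - S.p e i) (s e (i + 1)) ∧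
    0 < planeDet (S.p e (i + 2) - S.p e (i + 1)) (s e (i + 1))

theorem exists_isLeftShift : ∃ s, S.IsLeftShift s := by
  classical
  have h : ∀ e i, ∃ v : Plane, i + 1 < S.N e →
      0 < planeDet (S.p e (i + 1) - S.p e i) v ∧
      0 < planeDet (S.p e (i + 2) - S.p e (i + 1)) v := by
    intro e i
    by_cases hi : i + 1 < S.N e
    · obtain ⟨v, hv⟩ := exists_common_side ((S.chain e).1 i (by omega))
        ((S.chain e).1 (i + 1) hi).symm ((S.chain e).2.1 i hi)
      exact ⟨v, fun _ => hv⟩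
    · exact ⟨0, fun h => absurd h hi⟩
  choose f hf using h
  -- `f e i` belongs to corner `i + 1`. Truncated subtraction is harmless since corner `0` is a
  -- joint.
  refine ⟨fun e i => if S.IsJoint e i then 0 else f e (i - 1), fun e i hi => if_pos hi, ?_⟩
  intro e i hi hj
  simp only [if_neg hj, Nat.add_sub_cancel]
  exact hf e i hi

/-- A corner of the arc of `e`, moved along its shift vector. -/
def pt (s : E → ℕ → Plane) (t : ℝ) (e : E) (i : ℕ) : Plane := S.p e i + t • s e i

/-- The parameter of an arc (`false`) or of its parallel copy (`true`). -/
def param (τ : Bool) (ε : ℝ) : ℝ := if τ then ε else 0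

open Classical in
/-- The node at the `i`-th corner of the arc of `e` or of its parallel copy. -/
noncomputable def node (τ : Bool) (e : E) (i : ℕ) : V ⊕ E × Bool × ℕ :=
  if i = 0 then .inl (S.src e) else if i = S.N e then .inl (S.tgt e)
  -- Joints carry the tag `false` on both copies, which glues the copies there.
  else if S.IsJoint e i then .inr (e, false, i) else .inr (e, τ, i)

/-- The point of a node. -/
def nodePos (s : E → ℕ → Plane) (ε : ℝ) : V ⊕ E × Bool × ℕ → Plane
  | .inl v => S.pos v
  | .inr (e, τ, i) => S.pt s (param τ ε) e i

variable {S} {s : E → ℕ → Plane}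

@[simp] theorem pt_zero (e : E) (i : ℕ) : S.pt s 0 e i = S.p e i := by simp [pt]

@[simp] theorem param_zero (τ : Bool) : param τ 0 = 0 := by cases τ <;> rfl

theorem continuous_pt (τ : Bool) (e : E) (i : ℕ) :
    Continuous fun ε => S.pt s (param τ ε) e i := by
  cases τ
  · simp only [param, Bool.false_eq_true, if_false]; fun_prop
  · simp only [param, if_true, pt]; fun_prop

theorem node_zero (τ : Bool) (e : E) : S.node τ e 0 = .inl (S.src e) := by simp [node]

theorem node_end (τ : Bool) (e : E) : S.node τ e (S.N e) = .inl (S.tgt e) := by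
  have := S.nine_le e
  rw [node, if_neg (by omega), if_pos rfl]

theorem node_of_not_isJoint {e : E} {i : ℕ} (h : ¬ S.IsJoint e i) (τ : Bool) :
    S.node τ e i = .inr (e, τ, i) := by
  rw [node, if_neg (fun h' => h (Or.inl h')), if_neg (fun h' => h (Or.inr (Or.inr (Or.inr h')))),
    if_neg h]

theorem node_eq_of_isJoint {e : E} {i : ℕ} (h : S.IsJoint e i) (τ τ' : Bool) :
    S.node τ e i = S.node τ' e i := by
  simp only [node, if_pos h]

theorem node_mid {e : E} {i : ℕ} (h : i = 3 ∨ i = 6) (τ : Bool) :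
    S.node τ e i = .inr (e, false, i) := by
  have := S.nine_le e
  rw [node, if_neg (by omega), if_neg (by omega), if_pos (by unfold IsJoint; omega)]

theorem node_injOn (τ : Bool) (e : E) {i j : ℕ} (h : S.node τ e i = S.node τ e j) : i = j := by
  have hst := S.src_ne_tgt e
  unfold node at h
  split_ifs at h <;> simp_all [hst.symm]

theorem eq_of_node_eq {τ τ' : Bool} {e e' : E} {i j : ℕ} (hi : ¬ S.IsJoint e i)
    (h : S.node τ e i = S.node τ' e' j) : e = e' ∧ τ = τ' ∧ i = j := by
  rw [node_of_not_isJoint hi] at h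
  unfold node at h
  split_ifs at h with h1 h2 h3
  · simp only [Sum.inr.injEq, Prod.mk.injEq] at h
    obtain ⟨rfl, -, rfl⟩ := h
    exact absurd h3 hi
  · simpa using h

theorem IsLeftShift.pt_eq (hs : S.IsLeftShift s) {e : E} {i : ℕ} (h : S.IsJoint e i) (t : ℝ) :
    S.pt s t e i = S.p e i := by simp [pt, hs.1 e i h]

theorem IsLeftShift.nodePos_node (hs : S.IsLeftShift s) (ε : ℝ) (τ : Bool) (e : E) (i : ℕ) :
    S.nodePos s ε (S.node τ e i) = S.pt s (param τ ε) e i := by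
  unfold node
  split_ifs with h1 h2 h3
  · subst h1; rw [hs.pt_eq (Or.inl rfl), S.p_zero]; rfl
  · subst h2; rw [hs.pt_eq (Or.inr (Or.inr (Or.inr rfl))), S.p_end]; rfl
  · rw [hs.pt_eq h3]; simp only [nodePos]; rw [hs.pt_eq h3]
  · rfl

theorem IsLeftShift.left_end (hs : S.IsLeftShift s) {e : E} {i : ℕ} (hi : i < S.N e) :
    s e i = 0 ∨ 0 < planeDet (S.p e (i + 1) - S.p e i) (s e i) := by
  by_cases hj : S.IsJoint e i
  · exact Or.inl (hs.1 e i hj)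
  · obtain ⟨k, rfl⟩ : ∃ k, i = k + 1 := ⟨i - 1, by unfold IsJoint at hj; omega⟩
    exact Or.inr (hs.2 e k hi hj).2

theorem IsLeftShift.right_end (hs : S.IsLeftShift s) {e : E} {i : ℕ} (hi : i < S.N e) :
    s e (i + 1) = 0 ∨ 0 < planeDet (S.p e (i + 1) - S.p e i) (s e (i + 1)) := by
  by_cases hj : S.IsJoint e (i + 1)
  · exact Or.inl (hs.1 e _ hj)
  · exact Or.inr (hs.2 e i (by unfold IsJoint at hj; omega) hj).1

theorem IsLeftShift.isJoint_of_eq_zero (hs : S.IsLeftShift s) {e : E} {i : ℕ} (hi : i ≤ S.N e)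
    (h : s e i = 0) : S.IsJoint e i := by
  by_contra hj
  obtain ⟨k, rfl⟩ : ∃ k, i = k + 1 := ⟨i - 1, by unfold IsJoint at hj; omega⟩
  have := (hs.2 e k (by unfold IsJoint at hj; omega) hj).1
  simp [h, planeDet] at this

/-- Two segments of the doubled drawing meet at most in a common node. -/
def MeetInNode (S : ArcSystem V E) (s : E → ℕ → Plane) (ε : ℝ) (τ : Bool) (e : E) (i : ℕ)
    (τ' : Bool) (e' : E) (j : ℕ) : Prop :=
  ∀ x ∈ segment ℝ (S.pt s (param τ ε) e i) (S.pt s (param τ ε) e (i + 1)),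
    x ∈ segment ℝ (S.pt s (param τ' ε) e' j) (S.pt s (param τ' ε) e' (j + 1)) →
    ∃ w, w ∈ s(S.node τ e i, S.node τ e (i + 1)) ∧
      w ∈ s(S.node τ' e' j, S.node τ' e' (j + 1)) ∧ x = S.nodePos s ε w

theorem MeetInNode.symm {ε : ℝ} {τ τ' : Bool} {e e' : E} {i j : ℕ}
    (h : MeetInNode S s ε τ e i τ' e' j) : MeetInNode S s ε τ' e' j τ e i := by
  intro x hx hx'
  obtain ⟨w, h1, h2, h3⟩ := h x hx' hx
  exact ⟨w, h2, h1, h3⟩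

theorem eventually_meetInNode_of_disjoint (τ τ' : Bool) {e e' : E} {i j : ℕ}
    (h : Disjoint (segment ℝ (S.p e i) (S.p e (i + 1)))
      (segment ℝ (S.p e' j) (S.p e' (j + 1)))) :
    ∀ᶠ ε in 𝓝[>] (0 : ℝ), MeetInNode S s ε τ e i τ' e' j := by
  have := eventually_disjoint_segment (continuous_pt (S := S) (s := s) τ e i)
    (continuous_pt (S := S) (s := s) τ e (i + 1)) (continuous_pt (S := S) (s := s) τ' e' j)
    (continuous_pt (S := S) (s := s) τ' e' (j + 1)) (by simpa using h)
  filter_upwards [nhdsWithin_le_nhds this] with ε hε x hx hx'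
  exact absurd hx' (Set.disjoint_left.1 hε hx)

theorem IsLeftShift.eventually_meetInNode_same (hs : S.IsLeftShift s) {e : E} {i : ℕ}
    (hi : i < S.N e) : ∀ᶠ ε in 𝓝[>] (0 : ℝ), MeetInNode S s ε false e i true e i := by
  filter_upwards [self_mem_nhdsWithin] with ε hε x hx hx'
  -- Consecutive corners are never both joints, as `S.N e ≥ 9`.
  have hnot : ¬ (s e i = 0 ∧ s e (i + 1) = 0) := by
    rintro ⟨h1, h2⟩
    have h1 := hs.isJoint_of_eq_zero hi.le h1
    have h2 := hs.isJoint_of_eq_zero hi h2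
    have := S.nine_le e
    unfold IsJoint at h1 h2
    omega
  simp only [param, Bool.false_eq_true, if_false, pt_zero] at hx
  simp only [param, if_true, pt] at hx'
  rcases segment_inter_shift hε (hs.left_end hi) (hs.right_end hi) hnot hx hx' with
    ⟨h0, rfl⟩ | ⟨h0, rfl⟩
  · have hj := hs.isJoint_of_eq_zero hi.le h0
    refine ⟨S.node false e i, Sym2.mem_mk_left _ _, ?_, ?_⟩
    · rw [node_eq_of_isJoint hj false true]; exact Sym2.mem_mk_left _ _
    · rw [hs.nodePos_node, hs.pt_eq hj]
  · have hj := hs.isJoint_of_eq_zero hi h0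
    refine ⟨S.node false e (i + 1), Sym2.mem_mk_right _ _, ?_, ?_⟩
    · rw [node_eq_of_isJoint hj false true]; exact Sym2.mem_mk_right _ _
    · rw [hs.nodePos_node, hs.pt_eq hj]

theorem IsLeftShift.eventually_meetInNode_succ (hs : S.IsLeftShift s) (τ τ' : Bool) {e : E} {i : ℕ}
    (hi : i + 1 < S.N e) : ∀ᶠ ε in 𝓝[>] (0 : ℝ), MeetInNode S s ε τ e i τ' e (i + 1) := by
  have hbase := (S.chain e).2.1 i hi
  have hne1 := (S.chain e).1 i (by omega)
  have hne2 := ((S.chain e).1 (i + 1) hi).symm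
  by_cases hcase : τ = τ' ∨ S.IsJoint e (i + 1)
  · have hz : ∀ ε, S.pt s (param τ' ε) e (i + 1) = S.pt s (param τ ε) e (i + 1) := by
      intro ε
      rcases hcase with rfl | hj
      · rfl
      · rw [hs.pt_eq hj, hs.pt_eq hj]
    have hn : S.node τ' e (i + 1) = S.node τ e (i + 1) := by
      rcases hcase with rfl | hj
      · rfl
      · exact node_eq_of_isJoint hj _ _
    have := eventually_segment_inter_apex (continuous_pt (S := S) (s := s) τ e (i + 1))
      (continuous_pt (S := S) (s := s) τ e i) (continuous_pt (S := S) (s := s) τ' e (i + 2))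
      (by simpa using hne1) (by simpa using hne2) (by
        simp only [param_zero, pt_zero]; rwa [segment_symm ℝ (S.p e (i + 1)) (S.p e i)])
    filter_upwards [nhdsWithin_le_nhds this] with ε hε x hx hx'
    rw [hz] at hx'
    have hxz := hε x (by rwa [segment_symm]) hx'
    refine ⟨S.node τ e (i + 1), Sym2.mem_mk_right _ _, ?_, ?_⟩
    · rw [hn]; exact Sym2.mem_mk_left _ _
    · rw [hs.nodePos_node, hxz]
  · push Not at hcase
    obtain ⟨hτ, hj⟩ := hcase
    obtain ⟨d1, d2⟩ := hs.2 e i hi hj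
    cases τ <;> cases τ'
    · exact absurd rfl hτ
    · have hr : 0 ≤ 1 * planeDet (S.p e (i + 2) - S.p e (i + 1)) (s e (i + 2)) := by
        rw [one_mul]
        rcases hs.right_end hi with h | h
        · rw [h]; simp [planeDet]
        · exact h.le
      have := eventually_disjoint_shift_bend 1 (by rwa [one_mul]) (by rwa [one_mul]) hr hne2 hbase
      filter_upwards [this] with ε hε x hx hx'
      simp only [param, Bool.false_eq_true, if_false, pt_zero] at hx
      exact absurd hx' (Set.disjoint_left.1 hε hx)
    · have hr : 0 ≤ -1 * planeDet (S.p e i - S.p e (i + 1)) (s e i) := by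
        rcases hs.left_end (e := e) (i := i) (by omega) with h | h
        · rw [h]; simp [planeDet]
        · simp only [planeDet, PiLp.sub_apply] at h ⊢; linarith
      -- Here the earlier segment is the shifted one. Traversing the bend backwards turns left into
      -- right, hence the sign `-1`.
      have := eventually_disjoint_shift_bend (a := S.p e (i + 2)) (z := S.p e (i + 1))
        (b := S.p e i) (s := s e (i + 1)) (r := s e i) (-1)
        (by simp only [planeDet, PiLp.sub_apply] at d2 ⊢; linarith)
        (by simp only [planeDet, PiLp.sub_apply] at d1 ⊢; linarith) hr hne1
        (by
          intro x hx hx'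
          rw [segment_symm] at hx hx'
          exact hbase x hx' hx)
      filter_upwards [this] with ε hε x hx hx'
      simp only [param, Bool.false_eq_true, if_false, pt_zero] at hx'
      rw [segment_symm] at hx hx'
      exact absurd hx (Set.disjoint_left.1 hε hx')
    · exact absurd rfl hτ

/-- Writes a segment at a vertex as one issuing from that vertex, whichever end it is. The vertex
stays fixed because the ends of an arc are joints. -/
theorem IsLeftShift.exists_segment_eq (hs : S.IsLeftShift s) {v : V} {e : E} {i : ℕ}
    (hi : i < S.N e) (hv : S.pos v ∈ segment ℝ (S.p e i) (S.p e (i + 1))) :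
    ∃ j, S.p e j ≠ S.pos v ∧
      (∀ t, segment ℝ (S.pt s t e i) (S.pt s t e (i + 1)) =
        segment ℝ (S.pos v) (S.pt s t e j)) ∧
      ∀ τ, Sum.inl v ∈ s(S.node τ e i, S.node τ e (i + 1)) := by
  have hne := (S.chain e).1 i hi
  rcases S.pos_mem v e i hi hv with ⟨rfl, rfl⟩ | ⟨rfl, hN⟩
  · refine ⟨1, ?_, fun t => ?_, fun τ => ?_⟩
    · rw [← S.p_zero]; exact hne.symm
    · rw [hs.pt_eq (i := 0) (Or.inl rfl), S.p_zero]
    · rw [node_zero]; exact Sym2.mem_mk_left _ _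
  · refine ⟨i, ?_, fun t => ?_, fun τ => ?_⟩
    · rw [← S.p_end, ← hN]; exact hne
    · rw [segment_symm, hN, hs.pt_eq (i := S.N e) (Or.inr (Or.inr (Or.inr rfl))), S.p_end]
    · rw [hN, node_end]; exact Sym2.mem_mk_right _ _

theorem IsLeftShift.eventually_meetInNode_ne (hs : S.IsLeftShift s) (τ τ' : Bool) {e e' : E}
    (hee : e ≠ e') {i j : ℕ} (hi : i < S.N e) (hj : j < S.N e') :
    ∀ᶠ ε in 𝓝[>] (0 : ℝ), MeetInNode S s ε τ e i τ' e' j := by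
  by_cases hd : Disjoint (segment ℝ (S.p e i) (S.p e (i + 1)))
      (segment ℝ (S.p e' j) (S.p e' (j + 1)))
  · exact eventually_meetInNode_of_disjoint τ τ' hd
  obtain ⟨x, hx, hx'⟩ := Set.not_disjoint_iff.1 hd
  obtain ⟨v, rfl⟩ := S.inter e e' hee i hi j hj x hx hx'
  obtain ⟨k, hk, hseg, hnode⟩ := hs.exists_segment_eq hi hx
  obtain ⟨k', hk', hseg', hnode'⟩ := hs.exists_segment_eq hj hx'
  have hbase : ∀ x ∈ segment ℝ (S.pos v) (S.p e k), x ∈ segment ℝ (S.pos v) (S.p e' k') →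
      x = S.pos v := by
    intro y hy hy'
    have h1 := hseg 0
    have h2 := hseg' 0
    simp only [pt_zero] at h1 h2
    rw [← h1] at hy
    rw [← h2] at hy'
    -- The common point is some vertex `u`. One segment of an arc cannot touch both ends of the arc,
    -- so `u = v`.
    obtain ⟨u, rfl⟩ := S.inter e e' hee i hi j hj y hy hy'
    have := S.nine_le e
    rcases S.pos_mem _ _ _ hi hy with ⟨rfl, h⟩ | ⟨rfl, h⟩ <;>
      rcases S.pos_mem _ _ _ hi hx with ⟨rfl, h'⟩ | ⟨rfl, h'⟩ <;> first | rfl | omega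
  have := eventually_segment_inter_apex (z := fun _ => S.pos v) continuous_const
    (continuous_pt (S := S) (s := s) τ e k) (continuous_pt (S := S) (s := s) τ' e' k')
    (by simpa using hk) (by simpa using hk') (by simpa using hbase)
  filter_upwards [nhdsWithin_le_nhds this] with ε hε x hx hx'
  rw [hseg] at hx
  rw [hseg'] at hx'
  exact ⟨.inl v, hnode τ, hnode' τ', hε x hx hx'⟩

theorem IsLeftShift.eventually_meetInNode (hs : S.IsLeftShift s) {τ τ' : Bool} {e e' : E} {i j : ℕ}
    (hi : i < S.N e) (hj : j < S.N e') (hne : (τ, e, i) ≠ (τ', e', j)) :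
    ∀ᶠ ε in 𝓝[>] (0 : ℝ), MeetInNode S s ε τ e i τ' e' j := by
  by_cases hee : e = e'
  · subst hee
    rcases lt_trichotomy i j with h | rfl | h
    · rcases (show i + 1 ≤ j from h).eq_or_lt with rfl | h
      · exact hs.eventually_meetInNode_succ τ τ' hj
      · exact eventually_meetInNode_of_disjoint τ τ' ((S.chain e).2.2 i j h hj)
    · cases τ <;> cases τ'
      · exact absurd rfl hne
      · exact hs.eventually_meetInNode_same hi
      · exact (hs.eventually_meetInNode_same hi).mono fun _ h => h.symm
      · exact absurd rfl hne
    · rcases (show j + 1 ≤ i from h).eq_or_lt with rfl | h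
      · exact (hs.eventually_meetInNode_succ τ' τ hi).mono fun _ h => h.symm
      · exact eventually_meetInNode_of_disjoint τ τ' ((S.chain e).2.2 j i h hi).symm
  · exact hs.eventually_meetInNode_ne τ τ' hee hi hj

/-- Finitely many conditions, each true for all small `ε > 0`, hold simultaneously. Indexing by `Fin
(S.N e)` makes the finiteness visible. -/
theorem IsLeftShift.exists_parallel [Finite E] (hs : S.IsLeftShift s) : ∃ ε : ℝ,
    (∀ τ e i, i < S.N e → S.pt s (param τ ε) e i ≠ S.pt s (param τ ε) e (i + 1)) ∧
    ∀ τ e i τ' e' j, i < S.N e → j < S.N e' → (τ, e, i) ≠ (τ', e', j) →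
      MeetInNode S s ε τ e i τ' e' j := by
  have h1 : ∀ᶠ ε in 𝓝[>] (0 : ℝ), ∀ (τ : Bool) (α : Σ e, Fin (S.N e)),
      S.pt s (param τ ε) α.1 α.2 ≠ S.pt s (param τ ε) α.1 (α.2 + 1) := by
    simp only [eventually_all]
    rintro τ ⟨e, i, hi⟩
    refine nhdsWithin_le_nhds ?_
    have hc : ContinuousAt (fun ε => S.pt s (param τ ε) e i - S.pt s (param τ ε) e (i + 1)) 0 :=
      ((continuous_pt τ e i).sub (continuous_pt τ e (i + 1))).continuousAt
    have := hc.eventually_ne (y := 0) (by simpa [sub_eq_zero] using (S.chain e).1 i hi)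
    exact this.mono fun ε hε => sub_ne_zero.1 hε
  have h2 : ∀ᶠ ε in 𝓝[>] (0 : ℝ), ∀ (τ : Bool) (α : Σ e, Fin (S.N e)) (τ' : Bool)
      (β : Σ e, Fin (S.N e)), (τ, α.1, (α.2 : ℕ)) ≠ (τ', β.1, (β.2 : ℕ)) →
      MeetInNode S s ε τ α.1 α.2 τ' β.1 β.2 := by
    simp only [eventually_all]
    intro τ α τ' β hne
    exact hs.eventually_meetInNode α.2.2 β.2.2 hne
  obtain ⟨ε, h1, h2⟩ := (h1.and h2).exists
  exact ⟨ε, fun τ e i hi => h1 τ ⟨e, i, hi⟩,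
    fun τ e i τ' e' j hi hj hne => h2 τ ⟨e, i, hi⟩ τ' ⟨e', j, hj⟩ hne⟩

end ArcSystem

/-! ### The graph of pentagon chains -/

/-- The vertices of the graph in which every edge is replaced by a chain of three pentagons: the
old vertices, the two joints inside a chain, and the three further vertices of each pentagon. -/
inductive PentagonVertex (V E : Type*) where
  | base (v : V)
  | mid (e : E) (k : Fin 2)
  | side (e : E) (k : Fin 3) (j : Fin 3)

namespace PentagonVertex

instance {V E : Type*} [Finite V] [Finite E] : Finite (PentagonVertex V E) := by
  let f : PentagonVertex V E → V ⊕ (E × Fin 2) ⊕ (E × Fin 3 × Fin 3) := fun x => match x with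
    | base v => .inl v
    | mid e k => .inr (.inl (e, k))
    | side e k j => .inr (.inr (e, k, j))
  refine Finite.of_injective f ?_
  rintro (_ | _ | _) (_ | _ | _) h <;> simp_all [f]

variable {V E : Type*} (src tgt : E → V)

/-- The `k`-th joint of the chain of pentagons that replaces `e`. -/
def joint (e : E) : ℕ → PentagonVertex V E
  | 0 => base (src e)
  | 1 => mid e 0
  | 2 => mid e 1
  | _ => base (tgt e)

/-- The first end of an edge of the chain of pentagons. -/
def fst (d : E × Fin 3 × Fin 5) : PentagonVertex V E :=
  match d with
  -- Edges `0` and `1` form the short side of the pentagon, through `side e k 0`. Edges `2`, `3`,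
  -- `4` form the long side, through `side e k 1` and `side e k 2`.
  | (e, k, 0) => joint src tgt e k
  | (e, k, 1) => side e k 0
  | (e, k, 2) => joint src tgt e k
  | (e, k, 3) => side e k 1
  | (e, k, 4) => side e k 2

/-- The second end of an edge of the chain of pentagons. -/
def snd (d : E × Fin 3 × Fin 5) : PentagonVertex V E :=
  match d with
  | (e, k, 0) => side e k 0
  | (e, k, 1) => joint src tgt e (k + 1)
  | (e, k, 2) => side e k 1
  | (e, k, 3) => side e k 2
  | (e, k, 4) => joint src tgt e (k + 1)

theorem joint_ne_side (e e' : E) (i : ℕ) (k j : Fin 3) : joint src tgt e i ≠ side e' k j := by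
  unfold joint; split <;> simp

theorem fst_ne_snd (d : E × Fin 3 × Fin 5) : fst src tgt d ≠ snd src tgt d := by
  obtain ⟨e, k, j⟩ := d
  fin_cases j
  · exact joint_ne_side src tgt _ _ _ _ _
  · exact (joint_ne_side src tgt _ _ _ _ _).symm
  · exact joint_ne_side src tgt _ _ _ _ _
  · simp [fst, snd]
  · exact (joint_ne_side src tgt _ _ _ _ _).symm

end PentagonVertex

open PentagonVertex

/-- The graph in which every edge `e` is replaced by a chain of three pentagons. -/
def pentagonGraph {V E : Type*} (src tgt : E → V) : SimpleGraph (PentagonVertex V E) where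
  Adj x y := ∃ d, s(fst src tgt d, snd src tgt d) = s(x, y)
  symm := ⟨fun x y ⟨d, h⟩ => ⟨d, h.trans Sym2.eq_swap⟩⟩
  loopless := ⟨fun x ⟨d, h⟩ => by
    rcases Sym2.eq_iff.1 h with ⟨h1, h2⟩ | ⟨h1, h2⟩ <;> exact fst_ne_snd src tgt d (h1.trans h2.symm)⟩

theorem pentagonGraph_adj_fst_snd {V E : Type*} (src tgt : E → V) (d : E × Fin 3 × Fin 5) :
    (pentagonGraph src tgt).Adj (fst src tgt d) (snd src tgt d) := ⟨d, rfl⟩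

/-! ### Drawing the pentagon chains on the doubled arcs -/

namespace ArcSystem

variable {V E : Type*} (S : ArcSystem V E)

/-- The corner of the arc of `e` at which the `k`-th joint lies. -/
def jointIndex (e : E) (k : ℕ) : ℕ := if k = 3 then S.N e else 3 * k

/-- The node of a vertex. -/
def vertexNode : PentagonVertex V E → V ⊕ E × Bool × ℕ
  | base v => .inl v
  | mid e k => .inr (e, false, 3 * (k + 1))
  | side e k 0 => .inr (e, false, 3 * k + 1)
  | side e k 1 => .inr (e, true, 3 * k + 1)
  | side e k 2 => .inr (e, true, 3 * k + 2)

/-- The first corner of the arc of an edge. -/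
def start (d : E × Fin 3 × Fin 5) : ℕ :=
  match d with
  | (_, k, 0) => 3 * k
  | (_, k, 1) => 3 * k + 1
  | (_, k, 2) => 3 * k
  | (_, k, 3) => 3 * k + 1
  | (_, k, 4) => 3 * k + 2

/-- The last corner of the arc of an edge. -/
def finish (d : E × Fin 3 × Fin 5) : ℕ :=
  match d with
  | (_, k, 0) => 3 * k + 1
  -- This edge runs through several segments: the short side has one edge fewer than the long side,
  -- and the last pentagon extends to corner `S.N e`.
  | (e, k, 1) => S.jointIndex e (k + 1)
  | (_, k, 2) => 3 * k + 1
  | (_, k, 3) => 3 * k + 2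
  | (e, k, 4) => S.jointIndex e (k + 1)

/-- Whether an edge lies on the parallel copy. -/
def copy (d : E × Fin 3 × Fin 5) : Bool :=
  match d with
  | (_, _, 0) => false
  | (_, _, 1) => false
  | (_, _, 2) => true
  | (_, _, 3) => true
  | (_, _, 4) => true

variable {S}

theorem jointIndex_succ (e : E) (k : Fin 3) :
    (k : ℕ) < 2 ∧ S.jointIndex e (k + 1) = 3 * k + 3 ∨
      (k : ℕ) = 2 ∧ S.jointIndex e (k + 1) = S.N e := by
  unfold jointIndex
  split_ifs <;> omega

theorem start_lt (d : E × Fin 3 × Fin 5) : start d < S.finish d := by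
  obtain ⟨e, k, j⟩ := d
  have := S.nine_le e
  have := jointIndex_succ (S := S) e k
  fin_cases j <;> simp only [start, finish] <;> omega

theorem finish_le (d : E × Fin 3 × Fin 5) : S.finish d ≤ S.N d.1 := by
  obtain ⟨e, k, j⟩ := d
  have := S.nine_le e
  have := jointIndex_succ (S := S) e k
  fin_cases j <;> simp only [finish] <;> omega

theorem not_isJoint_of_between {d : E × Fin 3 × Fin 5} {i : ℕ} (h1 : start d < i)
    (h2 : i < S.finish d) : ¬ S.IsJoint d.1 i := by
  obtain ⟨e, k, j⟩ := d
  have := S.nine_le e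
  have := jointIndex_succ (S := S) e k
  unfold IsJoint
  fin_cases j <;> simp only [start, finish] at * <;> omega

theorem node_joint (e : E) (k : ℕ) (hk : k ≤ 3) (τ : Bool) :
    S.node τ e (S.jointIndex e k) = vertexNode (joint S.src S.tgt e k) := by
  match k, hk with
  | 0, _ => exact node_zero τ e
  | 1, _ => exact node_mid (by simp [jointIndex]) τ
  | 2, _ => exact node_mid (by simp [jointIndex]) τ
  | 3, _ => exact node_end τ e

theorem node_side (e : E) (k : Fin 3) (i : ℕ) (hi : i = 3 * k + 1 ∨ i = 3 * k + 2) (τ : Bool) :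
    S.node τ e i = .inr (e, τ, i) := by
  have := S.nine_le e
  apply node_of_not_isJoint
  unfold IsJoint
  omega

theorem node_start (d : E × Fin 3 × Fin 5) :
    S.node (copy d) d.1 (start d) = vertexNode (fst S.src S.tgt d) := by
  obtain ⟨e, k, j⟩ := d
  have hj : S.jointIndex e k = 3 * k := by unfold jointIndex; rw [if_neg (by omega)]
  fin_cases j
  · have h := node_joint (S := S) e k (by omega) false
    rw [hj] at h
    exact h
  · exact node_side e k _ (Or.inl rfl) _
  · have h := node_joint (S := S) e k (by omega) true
    rw [hj] at h
    exact h
  · exact node_side e k _ (Or.inl rfl) _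
  · exact node_side e k _ (Or.inr rfl) _

theorem node_finish (d : E × Fin 3 × Fin 5) :
    S.node (copy d) d.1 (S.finish d) = vertexNode (snd S.src S.tgt d) := by
  obtain ⟨e, k, j⟩ := d
  fin_cases j
  · exact node_side e k _ (Or.inl rfl) _
  · exact node_joint e _ (by omega) _
  · exact node_side e k _ (Or.inl rfl) _
  · exact node_side e k _ (Or.inr rfl) _
  · exact node_joint e _ (by omega) _

theorem vertexNode_injective : Function.Injective (vertexNode (V := V) (E := E)) := by
  rintro (v | ⟨e, k⟩ | ⟨e, k, j⟩) (v' | ⟨e', k'⟩ | ⟨e', k', j'⟩) h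
  · simpa [vertexNode] using h
  · simp [vertexNode] at h
  · fin_cases j' <;> simp [vertexNode] at h
  · simp [vertexNode] at h
  · simp only [vertexNode, Sum.inr.injEq, Prod.mk.injEq, true_and] at h
    obtain ⟨rfl, h⟩ := h
    congr; omega
  · fin_cases j' <;> simp [vertexNode] at h
    omega
  · fin_cases j <;> simp [vertexNode] at h
  · fin_cases j <;> simp [vertexNode] at h
    omega
  · fin_cases j <;> fin_cases j' <;> simp [vertexNode] at h <;> try omega
    all_goals
      obtain ⟨rfl, h⟩ := h
      congr; omega

/-- If no old vertex is isolated, replacing the edges by chains of pentagons keeps a drawing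
planar. -/
theorem isPlanar_pentagonGraph [Finite E] [Nonempty E]
    (hV : ∀ v, ∃ e, v = S.src e ∨ v = S.tgt e) : IsPlanar (pentagonGraph S.src S.tgt) := by
  obtain ⟨s, hs⟩ := S.exists_isLeftShift
  obtain ⟨ε, hne, hmeet⟩ := hs.exists_parallel
  refine isPlanar_of_straight_subdivision (S.nodePos s ε)
    (fun a b => ∃ τ e i, i < S.N e ∧ a = S.node τ e i ∧ b = S.node τ e (i + 1)) ?_ ?_
    _ vertexNode vertexNode_injective ?_ (fst S.src S.tgt) (snd S.src S.tgt)
    (fun d => S.finish d - start d) (fun d i => S.node (copy d) d.1 (start d + i))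
    (fun x y h => h) ?_ node_start ?_ ?_ ?_ ?_ ?_
  · rintro _ _ ⟨τ, e, i, hi, rfl, rfl⟩
    rw [hs.nodePos_node, hs.nodePos_node]
    exact hne τ e i hi
  · rintro _ _ _ _ ⟨τ, e, i, hi, rfl, rfl⟩ ⟨τ', e', j, hj, rfl, rfl⟩ hd x hx hx'
    simp only [hs.nodePos_node] at hx hx'
    refine hmeet τ e i τ' e' j hi hj ?_ x hx hx'
    rintro h
    simp only [Prod.mk.injEq] at h
    obtain ⟨rfl, rfl, rfl⟩ := h
    exact hd rfl
  · have adj := pentagonGraph_adj_fst_snd S.src S.tgt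
    rintro (v | ⟨e, k⟩ | ⟨e, k, j⟩)
    · obtain ⟨e, rfl | rfl⟩ := hV v
      · exact ⟨_, adj (e, 0, 0)⟩
      · exact ⟨_, (adj (e, 2, 1)).symm⟩
    · fin_cases k
      · exact ⟨_, adj (e, 1, 0)⟩
      · exact ⟨_, adj (e, 2, 0)⟩
    · fin_cases j
      · exact ⟨_, adj (e, k, 1)⟩
      · exact ⟨_, adj (e, k, 3)⟩
      · exact ⟨_, adj (e, k, 4)⟩
  · intro d
    have := start_lt (S := S) d
    omega
  · intro d
    have := start_lt (S := S) d
    rw [show start d + (S.finish d - start d) = S.finish d by omega]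
    exact node_finish d
  · intro d i hi
    have := finish_le (S := S) d
    exact ⟨copy d, d.1, start d + i, by omega, rfl, rfl⟩
  · intro d i _ j _ h
    have := node_injOn _ _ h
    omega
  -- An inner corner of an edge is not a joint, and all side vertices on its copy lie outside the
  -- open range from `start d` to `S.finish d`.
  · intro d i hi x h
    by_contra hcon
    have h1 : start d < start d + i := by omega
    have h2 : start d + i < S.finish d := by omega
    rw [node_of_not_isJoint (not_isJoint_of_between h1 h2)] at h
    have hN := S.nine_le d.1
    have hnj := not_isJoint_of_between h1 h2
    generalize start d + i = a at *
    obtain ⟨e, k, j⟩ := d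
    have hji := jointIndex_succ (S := S) e k
    rcases x with v | ⟨e', k'⟩ | ⟨e', k', j'⟩
    · simp [vertexNode] at h
    · simp only [vertexNode, Sum.inr.injEq, Prod.mk.injEq] at h
      unfold IsJoint at hnj
      omega
    · fin_cases j <;> fin_cases j' <;>
        simp [vertexNode, copy] at h <;> simp only [start, finish] at h1 h2 <;> omega
  · intro d d' hdd i hi j hj h
    by_contra hcon
    have h1 : start d < start d + i := by omega
    have h2 : start d + i < S.finish d := by omega
    have h3 : start d' ≤ start d' + j := by omega
    have h4 : start d' + j ≤ S.finish d' := by have := start_lt (S := S) d'; omega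
    obtain ⟨he, hc, hij⟩ := eq_of_node_eq (not_isJoint_of_between h1 h2) h
    rw [← hij] at h3 h4
    generalize start d + i = a at *
    obtain ⟨e, k, l⟩ := d
    obtain ⟨e', k', l'⟩ := d'
    dsimp only at he
    subst he
    have hN := S.nine_le e
    have hji := jointIndex_succ (S := S) e k
    have hji' := jointIndex_succ (S := S) e k'
    have hk : (k : ℕ) = k' → k = k' := Fin.ext
    fin_cases l <;> fin_cases l' <;> simp [copy] at hc <;> simp only [start, finish] at h1 h2 h3 h4 <;>
      first
      | omega
      | exact hdd (by rw [hk (by omega)])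

end ArcSystem

/-! ### Cycles as connected 2-regular subgraphs -/

/-- A finite connected `2`-regular subgraph of `G` with vertex set `T` and adjacency `A`. -/
structure IsCycleOn {V : Type*} (G : SimpleGraph V) (T : Finset V) (A : V → V → Prop) : Prop where
  nonempty : T.Nonempty
  adj : ∀ x y, A x y → G.Adj x y
  symm : ∀ x y, A x y → A y x
  mem : ∀ x y, A x y → x ∈ T
  two : ∀ x ∈ T, ∃ y z, y ≠ z ∧ ∀ w, A x w ↔ w = y ∨ w = z
  connected : ∀ Q : Set V, (∀ x y, A x y → x ∈ Q → y ∈ Q) → ∀ x ∈ T, x ∈ Q → ∀ y ∈ T, y ∈ Q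

theorem SimpleGraph.Walk.mem_of_adj_closed {V : Type*} {G : SimpleGraph V} {u v : V}
    (p : G.Walk u v) (Q : Set V) (hQ : ∀ x y, p.toSubgraph.Adj x y → x ∈ Q → y ∈ Q) (hu : u ∈ Q) :
    ∀ x ∈ p.support, x ∈ Q := by
  induction p with
  | nil => simpa using hu
  | cons h p ih =>
    intro x hx
    rcases List.mem_cons.1 (SimpleGraph.Walk.support_cons h p ▸ hx) with rfl | hx
    · exact hu
    · refine ih (fun a b hab => hQ a b ?_) (hQ _ _ ?_ hu) x hx
      · exact Or.inr hab
      · exact Or.inl rfl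

/-- Forgetting the starting point and the order of the walk makes the later case analysis local. -/
theorem SimpleGraph.Walk.IsCycle.exists_isCycleOn {V : Type*} {G : SimpleGraph V} {v : V}
    {c : G.Walk v v} (hc : c.IsCycle) : ∃ T A, IsCycleOn G T A ∧ T.card = c.length := by
  classical
  have hT : ∀ x, x ∈ c.support.tail.toFinset ↔ x ∈ c.support := by
    intro x
    rw [List.mem_toFinset, SimpleGraph.Walk.mem_support_iff]
    constructor
    · exact Or.inr
    · rintro (rfl | h)
      · exact SimpleGraph.Walk.end_mem_tail_support hc.not_nil
      · exact h
  -- The support lists `v` twice. Its tail lists every vertex once, so the cardinality is the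
  -- length.
  refine ⟨c.support.tail.toFinset, c.toSubgraph.Adj, ⟨⟨v, ?_⟩, ?_, ?_, ?_, ?_, ?_⟩, ?_⟩
  · exact (hT v).2 c.start_mem_support
  · exact fun x y h => h.adj_sub
  · exact fun x y h => h.symm
  · exact fun x y h => (hT x).2 (SimpleGraph.Walk.mem_support_of_adj_toSubgraph h)
  · intro x hx
    obtain ⟨y, z, hyz, h⟩ := Set.ncard_eq_two.1
      (hc.ncard_neighborSet_toSubgraph_eq_two ((hT x).1 hx))
    refine ⟨y, z, hyz, fun w => ?_⟩
    have : w ∈ c.toSubgraph.neighborSet x ↔ w ∈ ({y, z} : Set V) := by rw [h]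
    simpa using this
  · intro Q hQ x hx hxQ y hy
    -- By symmetry the complement of `Q` is closed too, and it would spread from `v` to `x`.
    have hv : v ∈ Q := by
      by_contra hv
      exact c.mem_of_adj_closed Qᶜ (fun a b hab ha hb => ha (hQ b a hab.symm hb)) hv x
        ((hT x).1 hx) hxQ
    exact c.mem_of_adj_closed Q hQ hv y ((hT y).1 hy)
  · rw [List.toFinset_card_of_nodup hc.support_nodup, List.length_tail,
      SimpleGraph.Walk.length_support, Nat.add_sub_cancel]

namespace IsCycleOn

variable {V : Type*} {G : SimpleGraph V} {T : Finset V} {A : V → V → Prop}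

theorem mem_right (h : IsCycleOn G T A) {x y : V} (hxy : A x y) : y ∈ T :=
  h.mem _ _ (h.symm _ _ hxy)

theorem exists_ne (h : IsCycleOn G T A) {x : V} (hx : x ∈ T) : ∃ y z, y ≠ z ∧ A x y ∧ A x z := by
  obtain ⟨y, z, hyz, hA⟩ := h.two x hx
  exact ⟨y, z, hyz, (hA y).2 (Or.inl rfl), (hA z).2 (Or.inr rfl)⟩

theorem eq_or_eq (h : IsCycleOn G T A) {x y z w : V} (hyz : y ≠ z) (hy : A x y) (hz : A x z)
    (hw : A x w) : w = y ∨ w = z := by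
  obtain ⟨a, b, hab, hA⟩ := h.two x (h.mem _ _ hy)
  rw [hA] at hy hz hw
  rcases hy with rfl | rfl <;> rcases hz with rfl | rfl <;> rcases hw with rfl | rfl <;> simp_all

theorem adj_of_degree_two (h : IsCycleOn G T A) {x a b : V} (hx : x ∈ T)
    (hab : ∀ y, G.Adj x y → y = a ∨ y = b) : A x a ∧ A x b := by
  obtain ⟨y, z, hyz, hy, hz⟩ := h.exists_ne hx
  rcases hab y (h.adj _ _ hy) with rfl | rfl <;> rcases hab z (h.adj _ _ hz) with rfl | rfl
  · exact absurd rfl hyz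
  · exact ⟨hy, hz⟩
  · exact ⟨hz, hy⟩
  · exact absurd rfl hyz

end IsCycleOn

theorem injective_vec_three {α : Type*} {a b c : α} (hab : a ≠ b) (hac : a ≠ c) (hbc : b ≠ c) :
    Function.Injective ![a, b, c] := by
  intro i j h
  fin_cases i <;> fin_cases j <;>
    first
    | rfl
    | exact absurd h hab
    | exact absurd h hac
    | exact absurd h hbc
    | exact absurd h.symm hab
    | exact absurd h.symm hac
    | exact absurd h.symm hbc

/-! ### Cycle lengths and colorings of the pentagon graph -/

section PentagonGraph

variable {V E : Type*} {src tgt : E → V}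

theorem joint_eq_base {e : E} {k : ℕ} {v : V} (hk : k ≤ 3) (h : joint src tgt e k = base v) :
    k = 0 ∧ v = src e ∨ k = 3 ∧ v = tgt e := by
  match k, hk with
  | 0, _ => left; simpa [joint, eq_comm] using h
  | 1, _ => simp [joint] at h
  | 2, _ => simp [joint] at h
  | 3, _ => right; simpa [joint, eq_comm] using h

theorem joint_eq_mid {e e' : E} {k : ℕ} {m : Fin 2} (hk : k ≤ 3)
    (h : joint src tgt e k = mid e' m) : k = m + 1 ∧ e = e' := by
  match k, hk with
  | 0, _ => simp [joint] at h
  | 1, _ => simp only [joint, mid.injEq] at h; obtain ⟨rfl, rfl⟩ := h; simp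
  | 2, _ => simp only [joint, mid.injEq] at h; obtain ⟨rfl, rfl⟩ := h; simp
  | 3, _ => simp [joint] at h

/-- The neighbours of a vertex that lie in the `k`-th pentagon of `e`. -/
theorem pentagonGraph_adj_cases {x y : PentagonVertex V E} (h : (pentagonGraph src tgt).Adj x y) :
    ∃ (e : E) (k : Fin 3),
      (x = joint src tgt e k ∧ (y = side e k 0 ∨ y = side e k 1)) ∨
      (x = joint src tgt e (k + 1) ∧ (y = side e k 0 ∨ y = side e k 2)) ∨
      (x = side e k 0 ∧ (y = joint src tgt e k ∨ y = joint src tgt e (k + 1))) ∨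
      (x = side e k 1 ∧ (y = joint src tgt e k ∨ y = side e k 2)) ∨
      (x = side e k 2 ∧ (y = side e k 1 ∨ y = joint src tgt e (k + 1))) := by
  obtain ⟨⟨e, k, j⟩, hd⟩ := h
  refine ⟨e, k, ?_⟩
  rcases Sym2.eq_iff.1 hd with ⟨rfl, rfl⟩ | ⟨rfl, rfl⟩ <;> fin_cases j <;> simp [fst, snd]

theorem adj_side_zero {e : E} {k : Fin 3} {y : PentagonVertex V E}
    (h : (pentagonGraph src tgt).Adj (side e k 0) y) :
    y = joint src tgt e k ∨ y = joint src tgt e (k + 1) := by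
  obtain ⟨e', k', h⟩ := pentagonGraph_adj_cases h
  rcases h with ⟨h, -⟩ | ⟨h, -⟩ | ⟨h, hy⟩ | ⟨h, -⟩ | ⟨h, -⟩
  · exact absurd h.symm (joint_ne_side src tgt _ _ _ _ _)
  · exact absurd h.symm (joint_ne_side src tgt _ _ _ _ _)
  · simp only [side.injEq, and_true] at h
    obtain ⟨rfl, rfl⟩ := h
    exact hy
  · simp at h
  · simp at h

theorem adj_side_one {e : E} {k : Fin 3} {y : PentagonVertex V E}
    (h : (pentagonGraph src tgt).Adj (side e k 1) y) :
    y = joint src tgt e k ∨ y = side e k 2 := by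
  obtain ⟨e', k', h⟩ := pentagonGraph_adj_cases h
  rcases h with ⟨h, -⟩ | ⟨h, -⟩ | ⟨h, -⟩ | ⟨h, hy⟩ | ⟨h, -⟩
  · exact absurd h.symm (joint_ne_side src tgt _ _ _ _ _)
  · exact absurd h.symm (joint_ne_side src tgt _ _ _ _ _)
  · simp at h
  · simp only [side.injEq, and_true] at h
    obtain ⟨rfl, rfl⟩ := h
    exact hy
  · simp at h

theorem adj_side_two {e : E} {k : Fin 3} {y : PentagonVertex V E}
    (h : (pentagonGraph src tgt).Adj (side e k 2) y) :
    y = side e k 1 ∨ y = joint src tgt e (k + 1) := by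
  obtain ⟨e', k', h⟩ := pentagonGraph_adj_cases h
  rcases h with ⟨h, -⟩ | ⟨h, -⟩ | ⟨h, -⟩ | ⟨h, -⟩ | ⟨h, hy⟩
  · exact absurd h.symm (joint_ne_side src tgt _ _ _ _ _)
  · exact absurd h.symm (joint_ne_side src tgt _ _ _ _ _)
  · simp at h
  · simp at h
  · simp only [side.injEq, and_true] at h
    obtain ⟨rfl, rfl⟩ := h
    exact hy

theorem adj_mid {e : E} {m : Fin 2} {y : PentagonVertex V E}
    (h : (pentagonGraph src tgt).Adj (mid e m) y) :
    (y = side e m.castSucc 0 ∨ y = side e m.castSucc 2) ∨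
      (y = side e m.succ 0 ∨ y = side e m.succ 1) := by
  obtain ⟨e', k, h⟩ := pentagonGraph_adj_cases h
  rcases h with ⟨h, hy⟩ | ⟨h, hy⟩ | ⟨h, -⟩ | ⟨h, -⟩ | ⟨h, -⟩
  · obtain ⟨hk, rfl⟩ := joint_eq_mid (by omega) h.symm
    rw [show k = m.succ from Fin.ext hk] at hy
    exact Or.inr hy
  · obtain ⟨hk, rfl⟩ := joint_eq_mid (by omega) h.symm
    rw [show k = m.castSucc from Fin.ext (by simpa using hk)] at hy
    exact Or.inl hy
  all_goals simp at h

theorem adj_base {v : V} {y : PentagonVertex V E} (h : (pentagonGraph src tgt).Adj (base v) y) :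
    ∃ e, (v = src e ∧ (y = side e 0 0 ∨ y = side e 0 1)) ∨
      (v = tgt e ∧ (y = side e 2 0 ∨ y = side e 2 2)) := by
  obtain ⟨e, k, h⟩ := pentagonGraph_adj_cases h
  refine ⟨e, ?_⟩
  rcases h with ⟨h, hy⟩ | ⟨h, hy⟩ | ⟨h, -⟩ | ⟨h, -⟩ | ⟨h, -⟩
  · rcases joint_eq_base (by omega) h.symm with ⟨hk, hv⟩ | ⟨hk, hv⟩
    · rw [show k = 0 from Fin.ext hk] at hy
      exact Or.inl ⟨hv, hy⟩
    · omega
  · rcases joint_eq_base (by omega) h.symm with ⟨hk, hv⟩ | ⟨hk, hv⟩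
    · omega
    · rw [show k = 2 from Fin.ext (by simpa using hk)] at hy
      exact Or.inr ⟨hv, hy⟩
  all_goals simp at h

theorem joint_ne_joint_succ (e : E) (k : Fin 3) :
    joint src tgt e k ≠ joint src tgt e (k + 1) := by
  fin_cases k <;> simp [joint]

variable {T : Finset (PentagonVertex V E)} {A : PentagonVertex V E → PentagonVertex V E → Prop}

namespace IsCycleOn

theorem side_zero (h : IsCycleOn (pentagonGraph src tgt) T A) {e : E} {k : Fin 3}
    (hm : side e k 0 ∈ T) :
    A (side e k 0) (joint src tgt e k) ∧ A (side e k 0) (joint src tgt e (k + 1)) :=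
  h.adj_of_degree_two hm fun _ => adj_side_zero

theorem side_one (h : IsCycleOn (pentagonGraph src tgt) T A) {e : E} {k : Fin 3}
    (hm : side e k 1 ∈ T) :
    A (side e k 1) (joint src tgt e k) ∧ A (side e k 1) (side e k 2) :=
  h.adj_of_degree_two hm fun _ => adj_side_one

theorem side_two (h : IsCycleOn (pentagonGraph src tgt) T A) {e : E} {k : Fin 3}
    (hm : side e k 2 ∈ T) :
    A (side e k 2) (side e k 1) ∧ A (side e k 2) (joint src tgt e (k + 1)) :=
  h.adj_of_degree_two hm fun _ => adj_side_two

theorem side_one_mem_iff (h : IsCycleOn (pentagonGraph src tgt) T A) {e : E} {k : Fin 3} :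
    side e k 2 ∈ T ↔ side e k 1 ∈ T :=
  ⟨fun hm => h.mem_right (h.side_two hm).1, fun hm => h.mem_right (h.side_one hm).2⟩

/-- A cycle that uses both sides of a pentagon is that pentagon. -/
theorem card_eq_five (h : IsCycleOn (pentagonGraph src tgt) T A)
    {e : E} {k : Fin 3} (h0 : side e k 0 ∈ T) (h1 : side e k 1 ∈ T) : T.card = 5 := by
  classical
  have h2 := h.side_one_mem_iff.2 h1
  obtain ⟨a0, a1⟩ := h.side_zero h0
  obtain ⟨b0, b1⟩ := h.side_one h1
  obtain ⟨c0, c1⟩ := h.side_two h2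
  -- Both cycle neighbours of each joint are already in this pentagon, so the cycle cannot leave it.
  have hT : T = {joint src tgt e k, joint src tgt e (k + 1), side e k 0, side e k 1, side e k 2} := by
    ext x
    constructor
    · intro hx
      refine (h.connected {x | x ∈ ({joint src tgt e k, joint src tgt e (k + 1), side e k 0,
        side e k 1, side e k 2} : Finset (PentagonVertex V E))} ?_ _ h0 (by simp) x hx)
      intro x y hxy hx
      simp only [Finset.mem_insert, Finset.mem_singleton, Set.mem_ofPred_eq] at hx ⊢
      rcases hx with rfl | rfl | rfl | rfl | rfl
      · have := h.eq_or_eq (by simp) (h.symm _ _ a0) (h.symm _ _ b0) hxy; tauto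
      · have := h.eq_or_eq (by simp) (h.symm _ _ a1) (h.symm _ _ c1) hxy; tauto
      · have := adj_side_zero (h.adj _ _ hxy); tauto
      · have := adj_side_one (h.adj _ _ hxy); tauto
      · have := adj_side_two (h.adj _ _ hxy); tauto
    · simp only [Finset.mem_insert, Finset.mem_singleton]
      rintro (rfl | rfl | rfl | rfl | rfl)
      · exact h.mem_right a0
      · exact h.mem_right a1
      · exact h0
      · exact h1
      · exact h2
  rw [hT]
  rw [Finset.card_insert_of_notMem, Finset.card_insert_of_notMem, Finset.card_insert_of_notMem,
    Finset.card_insert_of_notMem, Finset.card_singleton]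
  · simp
  · simp
  · simp [joint_ne_side]
  · simp [joint_ne_side, joint_ne_joint_succ]

/-- A cycle that is not a pentagon has at least `18` vertices. -/
theorem eighteen_le_card (h : IsCycleOn (pentagonGraph src tgt) T A) (hst : ∀ e, src e ≠ tgt e)
    (hsimple : ∀ e e', s(src e, tgt e) = s(src e', tgt e') → e = e')
    (hno : ∀ e k, ¬ (side e k 0 ∈ T ∧ side e k 1 ∈ T)) : 18 ≤ T.card := by
  classical
  let used : E → Fin 3 → Prop := fun e k => side e k 0 ∈ T ∨ side e k 1 ∈ T
  -- Only one side of each pentagon is available, so the two cycle neighbours of an inner joint lie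
  -- in different pentagons. A cycle entering a chain thus traverses all of it.
  have hmid : ∀ e (m : Fin 2), mid e m ∈ T → used e m.castSucc ∧ used e m.succ := by
    intro e m hm
    obtain ⟨y, z, hyz, hy, hz⟩ := h.exists_ne hm
    have hyT := h.mem_right hy
    have hzT := h.mem_right hz
    have := hno e m.castSucc
    have := hno e m.succ
    have i1 := h.side_one_mem_iff (e := e) (k := m.castSucc)
    rcases adj_mid (h.adj _ _ hy) with (rfl | rfl) | (rfl | rfl) <;>
      rcases adj_mid (h.adj _ _ hz) with (rfl | rfl) | (rfl | rfl) <;> simp only [used] <;> tauto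
  have hjoint : ∀ e k, used e k → joint src tgt e k ∈ T ∧ joint src tgt e (k + 1) ∈ T := by
    rintro e k (hu | hu)
    · exact ⟨h.mem_right (h.side_zero hu).1, h.mem_right (h.side_zero hu).2⟩
    · exact ⟨h.mem_right (h.side_one hu).1,
        h.mem_right (h.side_two (h.side_one_mem_iff.2 hu)).2⟩
  have h01 : ∀ e, used e 0 → used e 1 := fun e hu => (hmid e 0 (hjoint e 0 hu).2).2
  have h12 : ∀ e, used e 1 → used e 2 := fun e hu => (hmid e 1 (hjoint e 1 hu).2).2
  have h10 : ∀ e, used e 1 → used e 0 := fun e hu => (hmid e 0 (hjoint e 1 hu).1).1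
  have h21 : ∀ e, used e 2 → used e 1 := fun e hu => (hmid e 1 (hjoint e 2 hu).1).1
  have hall : ∀ e k, used e k → ∀ k', used e k' := by
    intro e k hu
    have h0 : used e 0 := by
      fin_cases k
      · exact hu
      · exact h10 e hu
      · exact h10 e (h21 e hu)
    intro k'
    fin_cases k'
    · exact h0
    · exact h01 e h0
    · exact h12 e (h01 e h0)
  -- For the same reason the traversed old edges have degree at least two at each old vertex on the
  -- cycle.
  have hbase : ∀ v, base v ∈ T → ∃ e e', e ≠ e' ∧ used e 0 ∧ used e' 0 ∧
      v ∈ s(src e, tgt e) ∧ v ∈ s(src e', tgt e') := by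
    intro v hv
    obtain ⟨y, z, hyz, hy, hz⟩ := h.exists_ne hv
    have hyT := h.mem_right hy
    have hzT := h.mem_right hz
    have huse : ∀ y ∈ T, ∀ e, (v = src e ∧ (y = side e 0 0 ∨ y = side e 0 1)) ∨
        (v = tgt e ∧ (y = side e 2 0 ∨ y = side e 2 2)) → used e 0 ∧ v ∈ s(src e, tgt e) := by
      rintro y hy e (⟨rfl, rfl | rfl⟩ | ⟨rfl, rfl | rfl⟩)
      · exact ⟨Or.inl hy, Sym2.mem_mk_left _ _⟩
      · exact ⟨Or.inr hy, Sym2.mem_mk_left _ _⟩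
      · exact ⟨hall e 2 (Or.inl hy) 0, Sym2.mem_mk_right _ _⟩
      · exact ⟨hall e 2 (Or.inr (h.side_one_mem_iff.1 hy)) 0, Sym2.mem_mk_right _ _⟩
    obtain ⟨e, he⟩ := adj_base (h.adj _ _ hy)
    obtain ⟨e', he'⟩ := adj_base (h.adj _ _ hz)
    refine ⟨e, e', ?_, (huse y hyT e he).1, (huse z hzT e' he').1, (huse y hyT e he).2,
      (huse z hzT e' he').2⟩
    rintro rfl
    have n0 := hno e 0
    have n2 := hno e 2
    have i2 := h.side_one_mem_iff (e := e) (k := 2)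
    have := hst e
    rcases he with ⟨rfl, rfl | rfl⟩ | ⟨rfl, rfl | rfl⟩ <;>
      rcases he' with ⟨hv', rfl | rfl⟩ | ⟨hv', rfl | rfl⟩ <;> first | exact this hv' | exact this hv'.symm | tauto
  have hother : ∀ v e, v ∈ s(src e, tgt e) → used e 0 →
      base v ∈ T ∧ ∃ e', e' ≠ e ∧ used e' 0 ∧ v ∈ s(src e', tgt e') := by
    intro v e hv hu
    have hvT : base v ∈ T := by
      rcases Sym2.mem_iff.1 hv with rfl | rfl
      · exact (hjoint e 0 hu).1
      · exact (hjoint e 2 (hall e 0 hu 2)).2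
    refine ⟨hvT, ?_⟩
    obtain ⟨a, b, hab, ha, hb, hva, hvb⟩ := hbase v hvT
    by_cases hae : a = e
    · exact ⟨b, fun hb => hab (hae.trans hb.symm), hb, hvb⟩
    · exact ⟨a, hae, ha, hva⟩
  obtain ⟨e₀, hu₀⟩ : ∃ e, used e 0 := by
    obtain ⟨x, hx⟩ := h.nonempty
    obtain ⟨y, -, -, hy, -⟩ := h.exists_ne hx
    have hyT := h.mem_right hy
    obtain ⟨e, k, hc⟩ := pentagonGraph_adj_cases (h.adj _ _ hy)
    refine ⟨e, hall e k ?_ 0⟩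
    have i := h.side_one_mem_iff (e := e) (k := k)
    rcases hc with ⟨-, rfl | rfl⟩ | ⟨-, rfl | rfl⟩ | ⟨rfl, -⟩ | ⟨rfl, -⟩ | ⟨rfl, -⟩ <;>
      simp only [used] <;> tauto
  have two_ends : ∀ {e e' u v}, u ≠ v → u ∈ s(src e, tgt e) → v ∈ s(src e, tgt e) →
      u ∈ s(src e', tgt e') → v ∈ s(src e', tgt e') → e = e' := by
    intro e e' u v huv h1 h2 h3 h4
    exact hsimple _ _ (((Sym2.mem_and_mem_iff huv).1 ⟨h1, h2⟩).trans
      ((Sym2.mem_and_mem_iff huv).1 ⟨h3, h4⟩).symm)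
  have hs₀ : src e₀ ∈ s(src e₀, tgt e₀) := Sym2.mem_mk_left _ _
  have ht₀ : tgt e₀ ∈ s(src e₀, tgt e₀) := Sym2.mem_mk_right _ _
  obtain ⟨huT, e₁, hne₁, hu₁, hv₁⟩ := hother (src e₀) e₀ hs₀ hu₀
  obtain ⟨hvT, e₂, hne₂, hu₂, hv₂⟩ := hother (tgt e₀) e₀ ht₀ hu₀
  -- Simplicity of the old graph enters here: an edge through both ends of `e₀` would be `e₀`.
  have hne₁₂ : e₁ ≠ e₂ := by
    rintro rfl
    exact hne₁ (two_ends (hst e₀) hv₁ hv₂ hs₀ ht₀)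
  obtain ⟨w, hw⟩ := Sym2.mem_iff_exists.1 hv₁
  have hwm : w ∈ s(src e₁, tgt e₁) := by rw [hw]; exact Sym2.mem_mk_right _ _
  have hwT := (hother w e₁ hwm hu₁).1
  have hwu : src e₀ ≠ w := by
    rintro rfl
    rcases Sym2.eq_iff.1 hw with ⟨h1, h2⟩ | ⟨h1, h2⟩ <;> exact hst e₁ (h1.trans h2.symm)
  have hwv : tgt e₀ ≠ w := by
    rintro rfl
    exact hne₁ (two_ends (hst e₀) hv₁ hwm hs₀ ht₀)
  let es : Fin 3 → E := ![e₀, e₁, e₂]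
  let vs : Fin 3 → V := ![src e₀, tgt e₀, w]
  have hes : Function.Injective es := injective_vec_three hne₁.symm hne₂.symm hne₁₂
  have hvs : Function.Injective vs := injective_vec_three (hst e₀) hwu hwv
  have hus : ∀ i k, used (es i) k := by
    intro i
    fin_cases i
    · exact hall _ _ hu₀
    · exact hall _ _ hu₁
    · exact hall _ _ hu₂
  have hvsT : ∀ i, base (vs i) ∈ T := by
    intro i
    fin_cases i
    · exact huT
    · exact hvT
    · exact hwT
  have hg : ∀ i k, ∃ j, side (es i) k j ∈ T := by
    intro i k
    rcases hus i k with hu | hu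
    · exact ⟨_, hu⟩
    · exact ⟨_, hu⟩
  choose g hg using hg
  have hm : ∀ i (m : Fin 2), mid (es i) m ∈ T := by
    intro i m
    fin_cases m
    · exact (hjoint _ _ (hus i 0)).2
    · exact (hjoint _ _ (hus i 1)).2
  -- Three old vertices, a side vertex in each of nine pentagons, and six inner joints: `3 + 9 + 6 =
  -- 18`.
  let φ : Fin 3 ⊕ (Fin 3 × Fin 3) ⊕ (Fin 3 × Fin 2) → T := fun x => match x with
    | .inl i => ⟨base (vs i), hvsT i⟩
    | .inr (.inl (i, k)) => ⟨side (es i) k (g i k), hg i k⟩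
    | .inr (.inr (i, m)) => ⟨mid (es i) m, hm i m⟩
  have hφ : Function.Injective φ := by
    rintro (i | ⟨i, k⟩ | ⟨i, m⟩) (i' | ⟨i', k'⟩ | ⟨i', m'⟩) hh <;>
      simp only [φ, Subtype.mk.injEq, base.injEq, side.injEq, mid.injEq, reduceCtorEq] at hh
    · rw [hvs hh]
    · rw [hes hh.1, hh.2.1]
    · rw [hes hh.1, hh.2]
  have := Fintype.card_le_of_injective φ hφ
  simpa using this

end IsCycleOn

theorem pentagonGraph_cycle_length (hst : ∀ e, src e ≠ tgt e)
    (hsimple : ∀ e e', s(src e, tgt e) = s(src e', tgt e') → e = e') {x : PentagonVertex V E}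
    {c : (pentagonGraph src tgt).Walk x x} (hc : c.IsCycle) : c.length = 5 ∨ 18 ≤ c.length := by
  obtain ⟨T, A, h, hT⟩ := hc.exists_isCycleOn
  rw [← hT]
  by_cases hno : ∀ e k, ¬ (side e k 0 ∈ T ∧ side e k 1 ∈ T)
  · exact Or.inr (h.eighteen_le_card hst hsimple hno)
  · push Not at hno
    obtain ⟨e, k, h0, h1⟩ := hno
    exact Or.inl (h.card_eq_five h0 h1)

theorem pentagonGraph_egirth [Nonempty E] (hst : ∀ e, src e ≠ tgt e)
    (hsimple : ∀ e e', s(src e, tgt e) = s(src e', tgt e') → e = e') :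
    (pentagonGraph src tgt).egirth = 5 := by
  apply le_antisymm
  · obtain ⟨e⟩ := ‹Nonempty E›
    have adj := pentagonGraph_adj_fst_snd src tgt
    have a₁ : (pentagonGraph src tgt).Adj (side e 0 0) (mid e 0) := adj (e, 0, 1)
    have a₂ : (pentagonGraph src tgt).Adj (mid e 0) (side e 0 2) := (adj (e, 0, 4)).symm
    have a₃ : (pentagonGraph src tgt).Adj (side e 0 2) (side e 0 1) := (adj (e, 0, 3)).symm
    have a₄ : (pentagonGraph src tgt).Adj (side e 0 1) (base (src e)) := (adj (e, 0, 2)).symm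
    have a₅ : (pentagonGraph src tgt).Adj (base (src e)) (side e 0 0) := adj (e, 0, 0)
    let c : (pentagonGraph src tgt).Walk (side e 0 0) (side e 0 0) :=
      .cons a₁ (.cons a₂ (.cons a₃ (.cons a₄ (.cons a₅ .nil))))
    have hc : c.IsCycle := by
      rw [SimpleGraph.Walk.isCycle_def, SimpleGraph.Walk.isTrail_def]
      refine ⟨?_, by simp [c], ?_⟩
      · simp [c]
      · simp [c]
    simpa [c] using SimpleGraph.egirth_le_length hc
  · rw [SimpleGraph.le_egirth]
    intro x c hc
    rcases pentagonGraph_cycle_length hst hsimple hc with h | h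
    · rw [h]; rfl
    · exact_mod_cast (show 5 ≤ c.length by omega)

theorem pentagonGraph_noCycleOfLength (hst : ∀ e, src e ≠ tgt e)
    (hsimple : ∀ e e', s(src e, tgt e) = s(src e', tgt e') → e = e') {m : ℕ} (hm : m ≤ 17) :
    NoCycleOfLength (pentagonGraph src tgt) (5 + 1) m := by
  intro x c hc h
  rcases pentagonGraph_cycle_length hst hsimple hc with h' | h' <;> omega

/-- A closed walk of length five in `C₅` has odd length, so it goes once around; `a` and `c` are two
steps apart on it. -/
theorem cycleGraph_five_pentagon : ∀ a b : Fin 5, (SimpleGraph.cycleGraph 5).Adj a b →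
    ∀ c, (SimpleGraph.cycleGraph 5).Adj b c → ∀ d, (SimpleGraph.cycleGraph 5).Adj a d →
    ∀ f, (SimpleGraph.cycleGraph 5).Adj d f → (SimpleGraph.cycleGraph 5).Adj f c →
    c = a + 2 ∨ c = a + 3 := by
  simp only [SimpleGraph.cycleGraph_adj]
  decide

/-- The two ends of a chain of three pentagons get different colors. -/
theorem pentagonGraph_hom_ne (φ : pentagonGraph src tgt →g SimpleGraph.cycleGraph 5) (e : E) :
    φ (base (src e)) ≠ φ (base (tgt e)) := by
  have adj := fun d => φ.map_adj (pentagonGraph_adj_fst_snd src tgt d)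
  have step : ∀ k : Fin 3, φ (joint src tgt e (k + 1)) = φ (joint src tgt e k) + 2 ∨
      φ (joint src tgt e (k + 1)) = φ (joint src tgt e k) + 3 := fun k =>
    cycleGraph_five_pentagon _ _ (adj (e, k, 0)) _ (adj (e, k, 1)) _ (adj (e, k, 2)) _
      (adj (e, k, 3)) (adj (e, k, 4))
  -- In `Fin 5`, adding `3` is subtracting `2`, and three terms `±2` never sum to `0`.
  have key : ∀ a b c d : Fin 5, (b = a + 2 ∨ b = a + 3) → (c = b + 2 ∨ c = b + 3) →
      (d = c + 2 ∨ d = c + 3) → a ≠ d := by decide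
  exact key _ _ _ _ (step 0) (step 1) (step 2)

end PentagonGraph

/-! ### From a plane drawing to the five-coloring -/

theorem IsArcChain.eq_zero_of_mem {n i : ℕ} {p : ℕ → Plane} (h : IsArcChain n p) (hi : i < n)
    (hm : p 0 ∈ segment ℝ (p i) (p (i + 1))) : i = 0 := by
  rcases i with _ | _ | i
  · rfl
  · exact absurd (h.2.1 0 hi _ (left_mem_segment ..) hm) (h.1 0 (by omega))
  · exact absurd hm (Set.disjoint_left.1 (h.2.2 0 (i + 2) (by omega) hi) (left_mem_segment ..))

theorem IsArcChain.succ_eq_of_mem {n i : ℕ} {p : ℕ → Plane} (h : IsArcChain n p) (hi : i < n)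
    (hm : p n ∈ segment ℝ (p i) (p (i + 1))) : i + 1 = n := by
  by_contra hne
  obtain ⟨m, rfl⟩ : ∃ m, n = m + 1 := ⟨n - 1, by omega⟩
  rcases (show i + 1 ≤ m by omega).eq_or_lt with rfl | hlt
  · exact absurd (h.2.1 i (by omega) _ hm (right_mem_segment ..)).symm (h.1 (i + 1) (by omega))
  · exact absurd (right_mem_segment ..)
      (Set.disjoint_left.1 (h.2.2 i m hlt (by omega)) hm)

/-- The edges of a graph on a linearly ordered vertex set, as increasing pairs. -/
abbrev OrientedEdge {V : Type*} [LinearOrder V] (G : SimpleGraph V) : Type _ :=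
  {e : V × V // G.Adj e.1 e.2 ∧ e.1 < e.2}

theorem OrientedEdge.ext_sym2 {V : Type*} [LinearOrder V] {G : SimpleGraph V}
    (e e' : OrientedEdge G) (h : s(e.1.1, e.1.2) = s(e'.1.1, e'.1.2)) : e = e' := by
  rcases Sym2.eq_iff.1 h with ⟨h1, h2⟩ | ⟨h1, h2⟩
  · exact Subtype.ext (Prod.ext h1 h2)
  · have := e.2.2
    rw [h1, h2] at this
    exact absurd this e'.2.2.not_gt

theorem PlaneDrawing.exists_arcSystem {V : Type*} [LinearOrder V] {G : SimpleGraph V}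
    (d : PlaneDrawing G) : ∃ S : ArcSystem V (OrientedEdge G),
      S.src = (fun e => e.1.1) ∧ S.tgt = fun e => e.1.2 := by
  -- The chain need only lie inside the arc, since the drawing's conditions on intersections pass to
  -- subsets.
  have h := fun e : OrientedEdge G => (d.isPolygonalArc _ _ e.2.1).exists_long_chain 8
  choose N p hN hp h0 hend hsub using h
  have hmem : ∀ e i, i < N e → segment ℝ (p e i) (p e (i + 1)) ⊆ d.arc s(e.1.1, e.1.2) := by
    intro e i hi
    exact (Set.subset_biUnion_of_mem (u := fun i => segment ℝ (p e i) (p e (i + 1)))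
      (Set.mem_Iio.2 hi)).trans (hsub e)
  refine ⟨⟨d.pos, fun e => e.1.1, fun e => e.1.2, N, p, fun e => e.2.1.ne, hN, hp, h0, hend, ?_, ?_⟩,
    rfl, rfl⟩
  · intro v e i hi hv
    rcases Sym2.mem_iff.1 (d.vertex_mem_arc _ e.2.1 v (hmem e i hi hv)) with rfl | rfl
    · rw [← h0] at hv
      exact Or.inl ⟨rfl, (hp e).eq_zero_of_mem hi hv⟩
    · rw [← hend] at hv
      exact Or.inr ⟨rfl, (hp e).succ_eq_of_mem hi hv⟩
  · intro e e' hee i hi j hj x hx hx'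
    obtain ⟨v, hv⟩ := d.arc_inter_arc _ e.2.1 _ e'.2.1
      (fun h => hee (OrientedEdge.ext_sym2 e e' h)) ⟨hmem e i hi hx, hmem e' j hj hx'⟩
    exact ⟨v, hv.symm⟩

/-- A planar graph without isolated vertices inherits a `5`-coloring from a `C₅`-coloring of the
graph in which its edges are replaced by chains of pentagons. -/
theorem SteinbergProperty.colorable_five {m : ℕ} (hm : m ≤ 17) (h : SteinbergProperty 5 m)
    {V : Type} [LinearOrder V] [Finite V] (G : SimpleGraph V) (hG : IsPlanar G)
    (hV : ∀ v, ∃ w, G.Adj v w) : G.Colorable 5 := by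
  -- Without an edge there is no pentagon, and the girth would not be `5`.
  rcases isEmpty_or_nonempty V with hE | ⟨⟨v₀⟩⟩
  · exact SimpleGraph.Colorable.of_isEmpty 5
  obtain ⟨d⟩ := hG
  obtain ⟨S, hsrc, htgt⟩ := d.exists_arcSystem
  have hedge : ∀ v w, G.Adj v w → ∃ e, s(S.src e, S.tgt e) = s(v, w) := by
    intro v w hvw
    rw [hsrc, htgt]
    rcases lt_or_gt_of_ne hvw.ne with hlt | hlt
    · exact ⟨⟨(v, w), hvw, hlt⟩, rfl⟩
    · exact ⟨⟨(w, v), hvw.symm, hlt⟩, Sym2.eq_swap⟩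
  have hend : ∀ v, ∃ e, v = S.src e ∨ v = S.tgt e := by
    intro v
    obtain ⟨w, hw⟩ := hV v
    obtain ⟨e, he⟩ := hedge v w hw
    exact ⟨e, Sym2.mem_iff.1 (by rw [he]; exact Sym2.mem_mk_left _ _)⟩
  have : Nonempty (OrientedEdge G) := ⟨(hend v₀).choose⟩
  have hsimple : ∀ e e', s(S.src e, S.tgt e) = s(S.src e', S.tgt e') → e = e' := by
    rw [hsrc, htgt]
    exact OrientedEdge.ext_sym2
  obtain ⟨φ⟩ := h _ (pentagonGraph S.src S.tgt) (S.isPlanar_pentagonGraph hend)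
    (by exact_mod_cast pentagonGraph_egirth S.src_ne_tgt hsimple)
    (pentagonGraph_noCycleOfLength S.src_ne_tgt hsimple hm)
  refine ⟨SimpleGraph.Coloring.mk (fun v => φ (base v)) ?_⟩
  intro v w hvw
  obtain ⟨e, he⟩ := hedge v w hvw
  have hne := pentagonGraph_hom_ne φ e
  rcases Sym2.eq_iff.1 he with ⟨h1, h2⟩ | ⟨h1, h2⟩
  · rwa [h1, h2] at hne
  · rw [h1, h2] at hne
    exact hne.symm

theorem exists_steinbergProperty {k n : ℕ} (h : steinbergNumber k ≤ n) :
    ∃ m ≤ n, SteinbergProperty k m := by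
  -- A strict bound on the infimum produces an actual `m` below it.
  have hlt : steinbergNumber k < (n + 1 : ℕ) :=
    h.trans_lt (by exact_mod_cast Nat.lt_succ_self n)
  unfold steinbergNumber at hlt
  simp only [iInf_lt_iff] at hlt
  obtain ⟨m, hm, hlt⟩ := hlt
  exact ⟨m, Nat.lt_succ_iff.1 (by exact_mod_cast hlt), hm⟩

theorem mainTheorem4 (hf : steinbergNumber 5 ≤ 17) {V : Type*} [Finite V] (G : SimpleGraph V)
    (hG : IsPlanar G) : G.Colorable 5 := by
  classical
  obtain ⟨m, hm, hS⟩ := exists_steinbergProperty (k := 5) (n := 17) hf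
  -- Passing to `Fin n` discards isolated vertices, supplies a linear order to orient the edges, and
  -- lands in `Type`, as `SteinbergProperty` demands.
  obtain ⟨n, ⟨g⟩⟩ := Finite.exists_equiv_fin {v : V // ∃ w, G.Adj v w}
  let f : Fin n ↪ V := g.symm.toEmbedding.trans (Function.Embedding.subtype _)
  have hfv : ∀ i, f i = (g.symm i : V) := fun _ => rfl
  have hfg : ∀ v (hv : ∃ w, G.Adj v w), f (g ⟨v, hv⟩) = v := by
    intro v hv; rw [hfv, Equiv.symm_apply_apply]
  obtain ⟨C⟩ := hS.colorable_five hm (G.comap f) (hG.comap f) (by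
    intro i
    obtain ⟨w, hw⟩ := (g.symm i).2
    have hw' : ∃ u, G.Adj w u := ⟨_, hw.symm⟩
    refine ⟨g ⟨w, hw'⟩, ?_⟩
    rw [SimpleGraph.comap_adj, hfg]
    exact hw)
  refine ⟨SimpleGraph.Coloring.mk
    -- Isolated vertices may take any color.
    (fun v => if hv : ∃ w, G.Adj v w then C (g ⟨v, hv⟩) else 0) ?_⟩
  intro v w hvw
  have hv : ∃ w, G.Adj v w := ⟨w, hvw⟩
  have hw : ∃ u, G.Adj w u := ⟨v, hvw.symm⟩
  simp only [dif_pos hv, dif_pos hw]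
  exact C.valid (by rw [SimpleGraph.comap_adj, hfg, hfg]; exact hvw)
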